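/- **Proposition (Monotonicity of the copula distance).** Say that a random vector $X\in\mathbb R^d$ with law $P$, continuous marginal distribution functions $F_1,\dots,F_d$ and marginal laws $P_1,\dots,P_d$ has a *Gaussian copula with parameter* $\Sigma$ ($\Sigma$ a nonsingular correlation matrix) if $$dP(x)=c(F_1(x_1),\dots,F_d(x_d))\,dP_1(x_1)\cdots dP_d(x_d),\qquad c(u)=|\Sigma|^{-1/2}\exp\!\big(-\tfrac12 z^{T}(\Sigma^{-1}-I)z\big),\quad z_k=\Phi^{-1}(u_k),$$ where $\Phi$ is the standard normal distribution function. For $i<j$ let $P_{ij}$ be the joint law of $[X_i,X_j]$, and for a divergence $\mathcal H$ with values in $[0,\infty]$ let $$CD_{\mathcal H}([X_i,X_j],[Y_i,Y_j])=\big|\mathcal H(P^X_{ij},P^X_iP^X_j)-\mathcal H(P^Y_{ij},P^Y_iP^Y_j)\big|.$$ Let $X,X',Y$ be random vectors in $\mathbb R^d$ with Gaussian copulas with parameters $\Sigma^X,\Sigma^{X'},\Sigma^Y$, let $i<j$, and suppose that $(\Sigma^X_{ij})^2$ and $(\Sigma^{X'}_{ij})^2$ lie on the same side of $(\Sigma^Y_{ij})^2$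 (both $\ge$ it or both $\le$ it). (The other entries of the parameters may in particular be held fixed, but need not be.) Put $$g=\big|(\Sigma^X_{ij})^2-(\Sigma^Y_{ij})^2\big|,\qquad g'=\big|(\Sigma^{X'}_{ij})^2-(\Sigma^Y_{ij})^2\big|.$$ 1. Let $\mathcal H$ be the KL divergence, the $\chi^2$ distance or the Hellinger distance, that is, the $\phi$-divergence $\mathcal H_\phi(\mu,\nu)=\int\phi\big(\tfrac{d\mu}{d\nu}\big)\,d\nu$ with $\phi(x)=x\log x$, $x^2-1$ or $(\sqrt x-1)^2$. Then $\mathcal H(P_{ij},P_iP_j)$ is finite for each of the three vectors, and $CD_{\mathcal H}([X_i,X_j],[Y_i,Y_j])\le CD_{\mathcal H}([X'_i,X'_j],[Y_i,Y_j])$ if $g\le g'$, with strict inequality if $g<g'$. 2. Let $\mathcal H=\mathcal H_\phi$ for an arbitrary convex $\phi:(0,\infty)\to\mathbb R$ with $\phi(1)=0$ (the value is $+\infty$ if the integral diverges), and suppose that $\mathcal H_\phi(P^Y_{ij},P^Y_iP^Y_j)<\infty$. Then $CD_{\mathcal H}([X_i,X_j],[Y_i,Y_j])\le CD_{\mathcal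 H}([X'_i,X'_j],[Y_i,Y_j])$ if $g\le g'$. 3. Suppose moreover that the $i$-th and $j$-th marginals of $X$, $X'$ and $Y$ are standard normal. Then the conclusions of 1 also hold for the Wasserstein-2 distance on the Euclidean plane, and for the maximum mean discrepancy $$\mathcal H_{\mathrm{MMD}}(\mu,\nu)=\Big(\mathbb E\,k(U,U')+\mathbb E\,k(V,V')-2\,\mathbb E\,k(U,V)\Big)^{1/2},\qquad U,U'\sim\mu,\ V,V'\sim\nu\text{ independent},$$ with any Gaussian kernel $k(x,y)=e^{-\gamma\|x-y\|_2^2}$, $\gamma>0$. -/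

import Mathlib

open MeasureTheory ProbabilityTheory
open scoped ENNReal

/-- The quantile function of the standard normal distribution: on `(0, 1)` it is the inverse of the
standard normal distribution function. -/
noncomputable def stdNormalQuantile (u : ℝ) : ℝ :=
  sInf {x : ℝ | u ≤ cdf (gaussianReal 0 1) x}

/-- The density of the Gaussian copula with parameter `S`, as a function on the unit cube. -/
noncomputable def gaussianCopulaDensity {d : ℕ} (S : Matrix (Fin d) (Fin d) ℝ)
    (u : Fin d → ℝ) : ℝ :=
  let x : Fin d → ℝ := fun k => stdNormalQuantile (u k)
  S.det ^ (-(1 / 2) : ℝ) * Real.exp (-(1 / 2) * (x ⬝ᵥ (S⁻¹ - 1).mulVec x))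

/-- The law of the `k`-th component of a random vector with law `P`. -/
noncomputable def marginal {d : ℕ} (P : Measure (Fin d → ℝ)) (k : Fin d) : Measure ℝ :=
  P.map (fun x => x k)

/-- The joint law of the `i`-th and the `j`-th component of a random vector with law `P`. -/
noncomputable def pairLaw {d : ℕ} (P : Measure (Fin d → ℝ)) (i j : Fin d) : Measure (ℝ × ℝ) :=
  P.map (fun x => (x i, x j))

/-- The product of the marginal laws of the `i`-th and the `j`-th component. -/
noncomputable def pairProd {d : ℕ} (P : Measure (Fin d → ℝ)) (i j : Fin d) : Measure (ℝ × ℝ) :=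
  (marginal P i).prod (marginal P j)

/-- A random vector with law `P` has a Gaussian copula with parameter `S`, a nonsingular
correlation matrix: its marginal distribution functions `F k` are continuous, and its law is
`c (F 1 x 1, ..., F d x d)` times the product of its marginals, where `c` is the Gaussian copula
density. (The marginals need not have Lebesgue densities.) -/
structure HasGaussianCopula {d : ℕ} (P : Measure (Fin d → ℝ))
    (S : Matrix (Fin d) (Fin d) ℝ) : Prop where
  posDef : S.PosDef
  diag_eq_one : ∀ k, S k k = 1
  continuous_cdf : ∀ k, Continuous (cdf (marginal P k))
  law_eq : P = (Measure.pi (marginal P)).withDensity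
    (fun x => ENNReal.ofReal (gaussianCopulaDensity S (fun k => cdf (marginal P k) (x k))))

/-- The dependence of the components `i` and `j`, measured by the divergence `H` between their
joint law and the product of their marginals. -/
noncomputable def dependence {d : ℕ} (H : Measure (ℝ × ℝ) → Measure (ℝ × ℝ) → ℝ≥0∞)
    (P : Measure (Fin d → ℝ)) (i j : Fin d) : ℝ≥0∞ :=
  H (pairLaw P i j) (pairProd P i j)

/-- The copula distance of the component pairs `(i, j)` of random vectors with laws `P` and `Q`:
the absolute difference of their dependences. Subtraction on `[0, ∞]` is truncated at `0`, so the
maximum is the absolute difference unless both dependences are infinite. -/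
noncomputable def copulaDist {d : ℕ} (H : Measure (ℝ × ℝ) → Measure (ℝ × ℝ) → ℝ≥0∞)
    (P Q : Measure (Fin d → ℝ)) (i j : Fin d) : ℝ≥0∞ :=
  max (dependence H P i j - dependence H Q i j) (dependence H Q i j - dependence H P i j)

open scoped Classical in
/-- The `φ`-divergence `∫ φ (dμ/dν) dν` of probability measures with `μ ≪ ν`, for a convex function
`φ` on `(0, ∞)` with `φ 1 = 0` (then the negative part is always integrable, and the integral is
nonnegative). It is infinite when the positive part is not integrable. -/
noncomputable def phiDiv {α : Type*} [MeasurableSpace α] (φ : ℝ → ℝ) (μ ν : Measure α) : ℝ≥0∞ :=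
  if μ ≪ ν ∧ Integrable (fun x => φ (μ.rnDeriv ν x).toReal) ν then
    ENNReal.ofReal (∫ x, φ (μ.rnDeriv ν x).toReal ∂ν)
  else ∞

/-- The squared Euclidean distance in the plane (the distance on `ℝ × ℝ` is the maximum one). -/
def sqDist (x y : ℝ × ℝ) : ℝ := (x.1 - y.1) ^ 2 + (x.2 - y.2) ^ 2

/-- The Wasserstein-2 distance of two laws in the Euclidean plane: the square root of the infimum
of the quadratic transport cost over all couplings. -/
noncomputable def wasserstein2 (μ ν : Measure (ℝ × ℝ)) : ℝ≥0∞ :=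
  (⨅ (π : Measure ((ℝ × ℝ) × (ℝ × ℝ))) (_ : π.map Prod.fst = μ) (_ : π.map Prod.snd = ν),
    ∫⁻ p, ENNReal.ofReal (sqDist p.1 p.2) ∂π) ^ (1 / 2 : ℝ)

/-- The Gaussian kernel `exp (-γ ‖x - y‖²)` on the Euclidean plane. -/
noncomputable def gaussianKernel (γ : ℝ) (x y : ℝ × ℝ) : ℝ := Real.exp (-γ * sqDist x y)

/-- The maximum mean discrepancy of two laws in the plane with respect to a Gaussian kernel. -/
noncomputable def gaussianMMD (γ : ℝ) (μ ν : Measure (ℝ × ℝ)) : ℝ≥0∞ :=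
  ENNReal.ofReal (Real.sqrt
    ((∫ p, gaussianKernel γ p.1 p.2 ∂(μ.prod μ)) + (∫ p, gaussianKernel γ p.1 p.2 ∂(ν.prod ν))
      - 2 * ∫ p, gaussianKernel γ p.1 p.2 ∂(μ.prod ν)))

/-- The gap `|(SX i j)² - (SY i j)²|` between the squared `(i, j)` entries. -/
def sqGap {d : ℕ} (SX SY : Matrix (Fin d) (Fin d) ℝ) (i j : Fin d) : ℝ :=
  |(SX i j) ^ 2 - (SY i j) ^ 2|

/-- For the divergence `H`, the dependences of the three vectors are finite, and the passage from
the pair `(P, Q)` with gap `g` to the pair `(P', Q)` with gap `g'` does not decrease the copula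
distance if `g ≤ g'`, and increases it strictly if `g < g'`. -/
def CopulaDistIncreases {d : ℕ} (H : Measure (ℝ × ℝ) → Measure (ℝ × ℝ) → ℝ≥0∞)
    (P P' Q : Measure (Fin d → ℝ)) (i j : Fin d) (g g' : ℝ) : Prop :=
  dependence H P i j ≠ ∞ ∧ dependence H P' i j ≠ ∞ ∧ dependence H Q i j ≠ ∞ ∧
    (g ≤ g' → copulaDist H P Q i j ≤ copulaDist H P' Q i j) ∧
    (g < g' → copulaDist H P Q i j < copulaDist H P' Q i j)

/-! Everything reduces to one fact: the dependence of the components `i`, `j` is a function `D r` of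
the squared correlation `r = ρ²`, nondecreasing on `[0, 1)`. If `r` and `r'` lie on the same side of
`s`, moving further from `s` can then only increase `|D r - D s|`, and does so strictly if `D` is
finite and strictly increasing (`copulaDist_le_copulaDist`, `copulaDist_lt_copulaDist`).

A law with a Gaussian copula is the image of a centred Gaussian law under coordinatewise quantile
transforms, so the pair law is the image of the bivariate normal law with correlation `ρ`, and the
product of the marginals the image of the standard one (`HasGaussianCopula.pairLaw_eq`,
`HasGaussianCopula.pairProd_eq`). The transforms are injective, hence drop out of every
`φ`-divergence (`phiDiv_map_withDensity`).

In the eigenbasis `(1, ±1)/√2` of the covariance matrix all integrals split into one-dimensional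
Gaussian ones. This gives `D` in closed form for KL, `χ²`, Hellinger and MMD, and for Wasserstein-2
a coupling whose cost is matched by a dual bound.

For a general convex `φ`, let `|c| ≤ 1`. Replacing one coordinate by `c y + s z` with independent
noise `z` and `c² + s² = 1` preserves the standard normal law, and averaging the density ratio over
`z` turns correlation `ρ` into `c ρ`. Jensen's inequality then gives monotonicity
(`integral_convex_bivariateRatio_le`); negative `c` shows that the sign of `ρ` is irrelevant. -/

/-- The standard normal law on the line. -/
noncomputable abbrev stdNormal : Measure ℝ := gaussianReal 0 1

/-- The standard normal law in the plane. -/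
noncomputable abbrev stdNormalPlane : Measure (ℝ × ℝ) := stdNormal.prod stdNormal

/-! ### Gaussian integrals on the line -/

theorem gaussianPDFReal_std (x : ℝ) :
    gaussianPDFReal 0 1 x = (Real.sqrt (2 * Real.pi))⁻¹ * Real.exp (-(1 / 2) * x ^ 2) := by
  rw [gaussianPDFReal]
  simp only [NNReal.coe_one, mul_one, sub_zero]
  congr 2
  ring

theorem stdNormal_eq_withDensity :
    stdNormal = volume.withDensity fun x => ENNReal.ofReal (gaussianPDFReal 0 1 x) :=
  gaussianReal_of_var_ne_zero 0 one_ne_zero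

theorem integrable_stdNormal_iff (f : ℝ → ℝ) :
    Integrable f stdNormal ↔ Integrable fun x => gaussianPDFReal 0 1 x * f x := by
  rw [stdNormal_eq_withDensity, integrable_withDensity_iff_integrable_smul' (by fun_prop) (by simp)]
  simp [ENNReal.toReal_ofReal (gaussianPDFReal_nonneg _ _ _)]

/-- Completing the square reduces every Gaussian integral below to a shifted `exp (-k x²)`. -/
theorem gaussianPDFReal_mul_exp_quadratic {a : ℝ} (b : ℝ) (h : 0 < 1 + 2 * a) (x : ℝ) :
    gaussianPDFReal 0 1 x * Real.exp (-a * x ^ 2 + b * x) =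
      (Real.sqrt (2 * Real.pi))⁻¹ * Real.exp (b ^ 2 / (2 * (1 + 2 * a))) *
        Real.exp (-((1 + 2 * a) / 2) * (x - b / (1 + 2 * a)) ^ 2) := by
  rw [gaussianPDFReal_std, mul_assoc, mul_assoc, ← Real.exp_add, ← Real.exp_add]
  congr 2
  field_simp
  ring

theorem integrable_exp_quadratic {a : ℝ} (b : ℝ) (h : 0 < 1 + 2 * a) :
    Integrable (fun x => Real.exp (-a * x ^ 2 + b * x)) stdNormal := by
  rw [integrable_stdNormal_iff]
  simp_rw [gaussianPDFReal_mul_exp_quadratic b h]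
  exact ((integrable_exp_neg_mul_sq (by positivity :
    0 < (1 + 2 * a) / 2)).comp_sub_right (b / (1 + 2 * a))).const_mul _

theorem integral_exp_quadratic {a : ℝ} (b : ℝ) (h : 0 < 1 + 2 * a) :
    ∫ x, Real.exp (-a * x ^ 2 + b * x) ∂stdNormal =
      (Real.sqrt (1 + 2 * a))⁻¹ * Real.exp (b ^ 2 / (2 * (1 + 2 * a))) := by
  rw [integral_gaussianReal_eq_integral_smul one_ne_zero]
  simp_rw [smul_eq_mul, gaussianPDFReal_mul_exp_quadratic b h]
  rw [integral_const_mul, integral_sub_right_eq_self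
    (fun x => Real.exp (-((1 + 2 * a) / 2) * x ^ 2)), integral_gaussian]
  have h1 : Real.pi / ((1 + 2 * a) / 2) = (2 * Real.pi) / (1 + 2 * a) := by field_simp
  have h2 : Real.sqrt (2 * Real.pi) ≠ 0 := by positivity
  rw [h1, Real.sqrt_div (by positivity)]
  field_simp

theorem integrable_exp_sq {t : ℝ} (h : 2 * t < 1) :
    Integrable (fun x => Real.exp (t * x ^ 2)) stdNormal := by
  simpa using integrable_exp_quadratic (a := -t) 0 (by linarith)

theorem integral_exp_sq {t : ℝ} (h : 2 * t < 1) :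
    ∫ x, Real.exp (t * x ^ 2) ∂stdNormal = (Real.sqrt (1 - 2 * t))⁻¹ := by
  simpa [sub_eq_add_neg] using integral_exp_quadratic (a := -t) 0 (by linarith)

theorem memLp_id_stdNormal : MemLp (fun x : ℝ => x) 2 stdNormal :=
  memLp_id_gaussianReal' 2 (by simp)

theorem integrable_sq_stdNormal : Integrable (fun x : ℝ => x ^ 2) stdNormal :=
  memLp_id_stdNormal.integrable_sq

theorem integral_sq_stdNormal : ∫ x, x ^ 2 ∂stdNormal = 1 := by
  have h := variance_fun_id_gaussianReal (μ := 0) (v := 1)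
  rw [variance_eq_integral (by fun_prop)] at h
  simpa [integral_id_gaussianReal] using h

/-! ### Densities of nondegenerate Gaussian vectors -/

/-- The density of the centred Gaussian law with covariance matrix `S` with respect to the
standard normal law. -/
noncomputable def gaussianRatio {n : Type*} [Fintype n] [DecidableEq n] (S : Matrix n n ℝ)
    (x : n → ℝ) : ℝ :=
  S.det ^ (-(1 / 2) : ℝ) * Real.exp (-(1 / 2) * (x ⬝ᵥ (S⁻¹ - 1).mulVec x))

section Vector

variable {n : Type*} [Fintype n]

theorem pi_stdNormal_eq_withDensity :
    Measure.pi (fun _ : n => stdNormal) =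
      volume.withDensity fun x => ENNReal.ofReal (∏ k, gaussianPDFReal 0 1 (x k)) := by
  refine Measure.pi_eq fun s hs => ?_
  have hind (x : n → ℝ) : (Set.univ.pi s).indicator (fun x => ∏ k, gaussianPDFReal 0 1 (x k)) x =
      ∏ k, (s k).indicator (gaussianPDFReal 0 1) (x k) := by
    by_cases hx : x ∈ Set.univ.pi s
    · rw [Set.indicator_of_mem hx]
      exact Finset.prod_congr rfl fun k _ => (Set.indicator_of_mem (hx k trivial) _).symm
    · rw [Set.indicator_of_notMem hx]
      simp only [Set.mem_pi, Set.mem_univ, true_imp_iff, not_forall] at hx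
      obtain ⟨k, hk⟩ := hx
      exact (Finset.prod_eq_zero (Finset.mem_univ k) (Set.indicator_of_notMem hk _)).symm
  have hsm : MeasurableSet (Set.univ.pi s) := MeasurableSet.univ_pi hs
  rw [withDensity_apply _ hsm, ← ofReal_integral_eq_lintegral_ofReal, ← integral_indicator hsm]
  · simp_rw [hind]
    rw [integral_fintype_prod_volume_eq_prod, ENNReal.ofReal_prod_of_nonneg]
    · refine Finset.prod_congr rfl fun k _ => ?_
      rw [integral_indicator (hs k), gaussianReal_apply_eq_integral _ one_ne_zero]
    · exact fun k _ => integral_nonneg fun x =>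
        Set.indicator_nonneg (fun y _ => gaussianPDFReal_nonneg _ _ _) _
  · exact (Integrable.fintype_prod (fun _ => integrable_gaussianPDFReal 0 1)).integrableOn
  · exact Filter.Eventually.of_forall fun x =>
      Finset.prod_nonneg fun k _ => gaussianPDFReal_nonneg _ _ _

variable [DecidableEq n]

theorem continuous_gaussianRatio (S : Matrix n n ℝ) : Continuous (gaussianRatio S) := by
  unfold gaussianRatio
  simp only [dotProduct, Matrix.mulVec]
  fun_prop

/-- The pointwise form of the change of variables `y = A x`: the form `yᵀ (A Aᵀ)⁻¹ y` becomes `xᵀ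
x`, and `det (A Aᵀ) ^ (-1/2)` is the Jacobian factor `|det A|⁻¹`. -/
theorem prod_gaussianPDFReal_mul_gaussianRatio (A : Matrix n n ℝ) (hA : A.det ≠ 0) (x : n → ℝ) :
    |A.det|⁻¹ * ∏ k, gaussianPDFReal 0 1 (x k) =
      (∏ k, gaussianPDFReal 0 1 (A.mulVec x k)) *
        gaussianRatio (A * A.transpose) (A.mulVec x) := by
  have hu : IsUnit A.det := isUnit_iff_ne_zero.2 hA
  have hpdf (y : n → ℝ) : ∏ k, gaussianPDFReal 0 1 (y k) =
      (∏ _k : n, (Real.sqrt (2 * Real.pi))⁻¹) * Real.exp (-(1 / 2) * (y ⬝ᵥ y)) := by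
    simp_rw [gaussianPDFReal_std, Finset.prod_mul_distrib, ← Real.exp_sum, dotProduct,
      Finset.mul_sum, sq]
  have hdet : (A * A.transpose).det ^ (-(1 / 2) : ℝ) = |A.det|⁻¹ := by
    rw [Matrix.det_mul, Matrix.det_transpose, ← abs_mul_abs_self, Real.rpow_neg (by positivity),
      ← Real.sqrt_eq_rpow, Real.sqrt_mul_self (abs_nonneg _)]
  have hq : A.mulVec x ⬝ᵥ ((A * A.transpose)⁻¹ - 1).mulVec (A.mulVec x) =
      x ⬝ᵥ x - A.mulVec x ⬝ᵥ A.mulVec x := by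
    rw [Matrix.sub_mulVec, dotProduct_sub, Matrix.one_mulVec, Matrix.mul_inv_rev,
      Matrix.mulVec_mulVec, Matrix.mul_assoc, Matrix.nonsing_inv_mul _ hu, Matrix.mul_one,
      Matrix.dotProduct_mulVec, ← Matrix.mulVec_transpose, ← Matrix.transpose_nonsing_inv,
      Matrix.transpose_transpose, Matrix.mulVec_mulVec, Matrix.nonsing_inv_mul _ hu,
      Matrix.one_mulVec]
  rw [gaussianRatio, hq, hpdf, hpdf, hdet, mul_mul_mul_comm, mul_left_comm, ← Real.exp_add]
  ring_nf

theorem map_mulVec_pi_stdNormal (A : Matrix n n ℝ) (hA : A.det ≠ 0) :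
    (Measure.pi fun _ : n => stdNormal).map A.mulVec =
      (Measure.pi fun _ : n => stdNormal).withDensity
        fun x => ENNReal.ofReal (gaussianRatio (A * A.transpose) x) := by
  have hm : Measurable A.mulVec := (Continuous.matrix_mulVec continuous_const continuous_id).measurable
  have hg : Measurable fun x : n → ℝ => ENNReal.ofReal (∏ k, gaussianPDFReal 0 1 (x k)) := by
    fun_prop
  have hr := (continuous_gaussianRatio (A * A.transpose)).measurable.ennreal_ofReal
  have hv := Real.map_matrix_volume_pi_eq_smul_volume_pi hA
  ext s hs
  rw [Measure.map_apply hm hs, withDensity_apply _ hs, pi_stdNormal_eq_withDensity,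
    withDensity_apply _ (hm hs), setLIntegral_withDensity_eq_setLIntegral_mul _ hg hr hs]
  -- Lebesgue measure is written as `|det A|` times its image under `A`, so that both sides become
  -- integrals over the preimage of `s`.
  have hvol : (volume : Measure (n → ℝ)) =
      ENNReal.ofReal |A.det| • Measure.map A.mulVec volume := by
    rw [show A.mulVec = Matrix.toLin' A from rfl, hv, smul_smul, ← ENNReal.ofReal_mul (abs_nonneg _),
      ← abs_mul, mul_inv_cancel₀ hA]
    simp
  conv_rhs => rw [hvol]
  rw [Measure.restrict_smul, lintegral_smul_measure, setLIntegral_map hs (hg.mul hr) hm, smul_eq_mul,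
    ← lintegral_const_mul' _ _ ENNReal.ofReal_ne_top]
  refine lintegral_congr fun x => ?_
  simp only [Pi.mul_apply]
  rw [← ENNReal.ofReal_mul (Finset.prod_nonneg fun k _ => gaussianPDFReal_nonneg _ _ _),
    ← prod_gaussianPDFReal_mul_gaussianRatio A hA, ← ENNReal.ofReal_mul (abs_nonneg _),
    mul_inv_cancel_left₀ (abs_ne_zero.2 hA)]

open scoped MatrixOrder in
theorem Matrix.PosDef.exists_mul_transpose {S : Matrix n n ℝ} (hS : S.PosDef) :
    ∃ A : Matrix n n ℝ, A.det ≠ 0 ∧ S = A * A.transpose := by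
  classical
  have hs := hS.posSemidef
  refine ⟨CFC.sqrt S, ?_, ?_⟩
  · have := hS.det_pos
    rw [hs.det_sqrt]
    simpa [RCLike.sqrt_of_nonneg this.le, Real.sqrt_ne_zero'] using this
  · have h := (Matrix.nonneg_iff_posSemidef.1 (CFC.sqrt_nonneg S)).isHermitian
    rw [Matrix.IsHermitian, Matrix.conjTranspose_eq_transpose_of_trivial] at h
    rw [h, CFC.sqrt_mul_sqrt_self S hs.nonneg]

end Vector

/-! ### Bivariate normal laws and pairs of components -/

theorem charFunDual_map_pi_stdNormal {n : Type*} [Fintype n] (a b : n → ℝ)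
    (L : StrongDual ℝ (ℝ × ℝ)) :
    charFunDual ((Measure.pi fun _ : n => stdNormal).map fun x => (a ⬝ᵥ x, b ⬝ᵥ x)) L =
      Complex.exp (-(((L (1, 0)) ^ 2 * (a ⬝ᵥ a) + 2 * (L (1, 0) * L (0, 1)) * (a ⬝ᵥ b) +
        (L (0, 1)) ^ 2 * (b ⬝ᵥ b) : ℝ) : ℂ) / 2) := by
  have hL (u v : ℝ) : L (u, v) = u * L (1, 0) + v * L (0, 1) := by
    rw [show ((u, v) : ℝ × ℝ) = u • ((1, 0) : ℝ × ℝ) + v • ((0, 1) : ℝ × ℝ) by simp, map_add,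
      map_smul, map_smul, smul_eq_mul, smul_eq_mul]
  rw [charFunDual_apply, integral_map (by unfold dotProduct; fun_prop) (by fun_prop)]
  have h1 (x : n → ℝ) : Complex.exp (L (a ⬝ᵥ x, b ⬝ᵥ x) * Complex.I) =
      ∏ k, Complex.exp ((L (1, 0) * a k + L (0, 1) * b k : ℝ) * x k * Complex.I) := by
    rw [← Complex.exp_sum, hL]
    congr 1
    rw [← Finset.sum_mul]
    congr 1
    simp only [dotProduct]
    push_cast
    rw [Finset.sum_mul, Finset.sum_mul, ← Finset.sum_add_distrib]
    exact Finset.sum_congr rfl fun k _ => by ring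
  simp_rw [h1]
  rw [integral_fintype_prod_eq_prod fun k (y : ℝ) =>
    Complex.exp ((L (1, 0) * a k + L (0, 1) * b k : ℝ) * y * Complex.I)]
  simp_rw [← charFun_apply_real, charFun_gaussianReal]
  rw [← Complex.exp_sum]
  congr 1
  simp only [dotProduct]
  push_cast
  simp only [Finset.mul_sum, ← Finset.sum_add_distrib, ← Finset.sum_neg_distrib, Finset.sum_div]
  refine Finset.sum_congr rfl fun k _ => ?_
  ring

/-- Two linear images of standard normal vectors in the plane have the same law if their
covariances agree. -/
theorem map_pi_stdNormal_eq_of_cov {n m : Type*} [Fintype n] [Fintype m] {a b : n → ℝ}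
    {a' b' : m → ℝ} (haa : a ⬝ᵥ a = a' ⬝ᵥ a') (hab : a ⬝ᵥ b = a' ⬝ᵥ b')
    (hbb : b ⬝ᵥ b = b' ⬝ᵥ b') :
    ((Measure.pi fun _ : n => stdNormal).map fun x => (a ⬝ᵥ x, b ⬝ᵥ x)) =
      (Measure.pi fun _ : m => stdNormal).map fun x => (a' ⬝ᵥ x, b' ⬝ᵥ x) := by
  refine Measure.ext_of_charFunDual (funext fun L => ?_)
  rw [charFunDual_map_pi_stdNormal, charFunDual_map_pi_stdNormal, haa, hab, hbb]

/-- The density of the centred bivariate normal law with unit variances and correlation `ρ` with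
respect to the standard normal law in the plane. -/
noncomputable def bivariateRatio (ρ : ℝ) (p : ℝ × ℝ) : ℝ :=
  (Real.sqrt (1 - ρ ^ 2))⁻¹ *
    Real.exp (-(1 / 2) * ((ρ ^ 2 * p.1 ^ 2 + ρ ^ 2 * p.2 ^ 2 - 2 * ρ * (p.1 * p.2)) / (1 - ρ ^ 2)))

/-- A linear map of the plane which sends the standard normal law to the centred bivariate normal
law with unit variances and correlation `ρ`. -/
noncomputable def correlate (ρ : ℝ) (p : ℝ × ℝ) : ℝ × ℝ :=
  ((Real.sqrt (1 + ρ) * p.1 + Real.sqrt (1 - ρ) * p.2) / Real.sqrt 2,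
    (Real.sqrt (1 + ρ) * p.1 - Real.sqrt (1 - ρ) * p.2) / Real.sqrt 2)

theorem continuous_correlate (ρ : ℝ) : Continuous (correlate ρ) := by
  unfold correlate
  fun_prop

theorem continuous_bivariateRatio (ρ : ℝ) : Continuous (bivariateRatio ρ) := by
  unfold bivariateRatio
  fun_prop

theorem measurable_bivariateRatio (ρ : ℝ) :
    Measurable fun p => ENNReal.ofReal (bivariateRatio ρ p) :=
  (continuous_bivariateRatio ρ).measurable.ennreal_ofReal

theorem bivariateRatio_pos {ρ : ℝ} (hρ : ρ ^ 2 < 1) (p : ℝ × ℝ) : 0 < bivariateRatio ρ p := by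
  have : 0 < 1 - ρ ^ 2 := by linarith
  unfold bivariateRatio
  positivity

theorem map_withDensity_comp {α β : Type*} [MeasurableSpace α] [MeasurableSpace β] (μ : Measure α)
    {f : α → β} (hf : Measurable f) {g : β → ℝ≥0∞} (hg : Measurable g) :
    (μ.withDensity (g ∘ f)).map f = (μ.map f).withDensity g := by
  ext s hs
  rw [Measure.map_apply hf hs, withDensity_apply _ (hf hs), withDensity_apply _ hs,
    setLIntegral_map hs hg hf]
  rfl

theorem map_pi_fin_two_stdNormal :
    (Measure.pi fun _ : Fin 2 => stdNormal).map (fun x => (x 0, x 1)) = stdNormalPlane :=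
  (measurePreserving_finTwoArrow stdNormal).map_eq

section

variable {ρ : ℝ}

/-- The matrix of `correlate ρ`. -/
noncomputable def correlateMatrix (ρ : ℝ) : Matrix (Fin 2) (Fin 2) ℝ :=
  !![Real.sqrt (1 + ρ) / Real.sqrt 2, Real.sqrt (1 - ρ) / Real.sqrt 2;
    Real.sqrt (1 + ρ) / Real.sqrt 2, -(Real.sqrt (1 - ρ) / Real.sqrt 2)]

theorem one_add_pos_of_sq_lt_one (hρ : ρ ^ 2 < 1) : 0 < 1 + ρ := by nlinarith

theorem one_sub_pos_of_sq_lt_one (hρ : ρ ^ 2 < 1) : 0 < 1 - ρ := by nlinarith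

theorem correlateMatrix_mul_transpose (hρ : ρ ^ 2 < 1) :
    correlateMatrix ρ * (correlateMatrix ρ).transpose = !![1, ρ; ρ, 1] := by
  have h1 := Real.mul_self_sqrt (one_add_pos_of_sq_lt_one hρ).le
  have h2 := Real.mul_self_sqrt (one_sub_pos_of_sq_lt_one hρ).le
  rw [correlateMatrix]
  ext i j
  fin_cases i <;> fin_cases j <;>
    simp [Matrix.mul_apply, Fin.sum_univ_two, div_mul_div_comm, h1, h2] <;> ring

theorem correlateMatrix_det_ne_zero (hρ : ρ ^ 2 < 1) : (correlateMatrix ρ).det ≠ 0 := by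
  have h := congrArg Matrix.det (correlateMatrix_mul_transpose hρ)
  rw [Matrix.det_mul, Matrix.det_transpose, Matrix.det_fin_two_of] at h
  intro h0
  rw [h0] at h
  nlinarith

theorem correlateMatrix_mulVec (x : Fin 2 → ℝ) :
    ((correlateMatrix ρ).mulVec x 0, (correlateMatrix ρ).mulVec x 1) =
      correlate ρ (x 0, x 1) := by
  simp only [correlateMatrix, correlate, Matrix.mulVec, dotProduct, Fin.sum_univ_two]
  simp
  constructor <;> ring

theorem gaussianRatio_fin_two (hρ : ρ ^ 2 < 1) (x : Fin 2 → ℝ) :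
    gaussianRatio !![1, ρ; ρ, 1] x = bivariateRatio ρ (x 0, x 1) := by
  have h : 0 < 1 - ρ ^ 2 := by linarith
  rw [gaussianRatio, bivariateRatio, Matrix.inv_def, Matrix.adjugate_fin_two_of,
    Matrix.det_fin_two_of, Ring.inverse_eq_inv', show (1 : ℝ) * 1 - ρ * ρ = 1 - ρ ^ 2 by ring,
    Real.rpow_neg h.le, ← Real.sqrt_eq_rpow]
  congr 3
  simp [Matrix.mulVec, dotProduct, Fin.sum_univ_two, Matrix.sub_apply]
  field_simp
  ring

theorem map_correlate (ρ : ℝ) :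
    stdNormalPlane.map (correlate ρ) = (Measure.pi fun _ : Fin 2 => stdNormal).map
      fun x => (correlateMatrix ρ 0 ⬝ᵥ x, correlateMatrix ρ 1 ⬝ᵥ x) := by
  rw [← map_pi_fin_two_stdNormal, Measure.map_map (continuous_correlate ρ).measurable (by fun_prop)]
  congr 1
  ext1 x
  exact (correlateMatrix_mulVec x).symm

theorem withDensity_bivariateRatio (hρ : ρ ^ 2 < 1) :
    stdNormalPlane.withDensity (fun p => ENNReal.ofReal (bivariateRatio ρ p)) =
      stdNormalPlane.map (correlate ρ) := by
  have hm : Measurable (correlateMatrix ρ).mulVec :=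
    (Continuous.matrix_mulVec continuous_const continuous_id).measurable
  have he : Measurable fun x : Fin 2 → ℝ => (x 0, x 1) := by fun_prop
  rw [map_correlate]
  conv_lhs => rw [← map_pi_fin_two_stdNormal]
  rw [← map_withDensity_comp _ he (measurable_bivariateRatio ρ)]
  have h := map_mulVec_pi_stdNormal _ (correlateMatrix_det_ne_zero hρ)
  rw [correlateMatrix_mul_transpose hρ] at h
  simp_rw [gaussianRatio_fin_two hρ] at h
  rw [show (fun p => ENNReal.ofReal (bivariateRatio ρ p)) ∘ (fun x : Fin 2 → ℝ => (x 0, x 1)) =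
    fun x => ENNReal.ofReal (bivariateRatio ρ (x 0, x 1)) from rfl, ← h, Measure.map_map he hm]
  rfl

/-- The law of a pair of components of a Gaussian vector whose covariance matrix is a
correlation matrix. -/
theorem map_pair_withDensity_gaussianRatio {n : Type*} [Fintype n] [DecidableEq n]
    {S : Matrix n n ℝ} (hS : S.PosDef) (hdiag : ∀ k, S k k = 1) (i j : n) (hρ : (S i j) ^ 2 < 1) :
    ((Measure.pi fun _ : n => stdNormal).withDensity
      fun x => ENNReal.ofReal (gaussianRatio S x)).map (fun x => (x i, x j)) =
        stdNormalPlane.map (correlate (S i j)) := by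
  obtain ⟨B, hB, rfl⟩ := hS.exists_mul_transpose
  set S := B * B.transpose with hSdef
  have hm : Measurable B.mulVec := (Continuous.matrix_mulVec continuous_const continuous_id).measurable
  have he : Measurable fun x : n → ℝ => (x i, x j) := by fun_prop
  have hC := correlateMatrix_mul_transpose hρ
  have hC' (k l : Fin 2) : correlateMatrix (S i j) k ⬝ᵥ correlateMatrix (S i j) l =
      (!![1, S i j; S i j, 1] : Matrix (Fin 2) (Fin 2) ℝ) k l := by
    rw [← hC]
    rfl
  -- Both laws are now linear images of standard normal vectors, by the rows `i`, `j` of `B` and by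
  -- the two rows of `correlateMatrix`; only the inner products of the rows have to be compared.
  rw [map_correlate, ← map_mulVec_pi_stdNormal B hB, Measure.map_map he hm]
  refine map_pi_stdNormal_eq_of_cov ?_ ?_ ?_
  · rw [hC']
    exact hdiag i
  · rw [hC']
    rfl
  · rw [hC']
    exact hdiag j

/-- The principal minor on `i`, `j` is `1 - (S i j)²`, and it is positive. -/
theorem sq_lt_one_of_posDef {n : Type*} [Fintype n] {S : Matrix n n ℝ} (hS : S.PosDef)
    (hdiag : ∀ k, S k k = 1) {i j : n} (hij : i ≠ j) : (S i j) ^ 2 < 1 := by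
  have h := (hS.submatrix (e := ![i, j]) (by
    intro a b
    fin_cases a <;> fin_cases b <;> simp [hij, hij.symm])).det_pos
  have hsymm : S j i = S i j := by simpa using hS.isHermitian.apply i j
  rw [Matrix.det_fin_two] at h
  simp [hdiag, hsymm] at h
  nlinarith

end

/-! ### Quantile transforms -/

theorem strictMono_cdf_stdNormal : StrictMono (cdf stdNormal) := by
  intro x y hxy
  refine lt_of_le_of_ne (monotone_cdf _ hxy.le) fun h => ?_
  have h0 : stdNormal (Set.Ioc x y) = 0 := by
    rw [← measure_cdf stdNormal, StieltjesFunction.measure_Ioc, h, sub_self, ENNReal.ofReal_zero]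
  have h1 : volume (Set.Ioc x y) = 0 := gaussianReal_absolutelyContinuous' 0 one_ne_zero h0
  rw [Real.volume_Ioc, ENNReal.ofReal_eq_zero] at h1
  linarith

theorem continuous_cdf_of_nullSingleton (μ : Measure ℝ) [IsProbabilityMeasure μ]
    (h : ∀ x, μ {x} = 0) : Continuous (cdf μ) := by
  refine continuous_iff_continuousAt.2 fun x => ?_
  rw [(monotone_cdf μ).continuousAt_iff_leftLim_eq_rightLim, StieltjesFunction.rightLim_eq]
  have h1 := h x
  rw [← measure_cdf μ, StieltjesFunction.measure_singleton, ENNReal.ofReal_eq_zero] at h1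
  exact le_antisymm ((monotone_cdf μ).leftLim_le le_rfl) (by linarith)

theorem continuous_cdf_stdNormal : Continuous (cdf stdNormal) :=
  continuous_cdf_of_nullSingleton _ fun x => by
    have := nullSingletonClass_gaussianReal (μ := 0) (v := 1) one_ne_zero
    exact measure_singleton x

theorem cdf_stdNormal_pos (x : ℝ) : 0 < cdf stdNormal x :=
  (cdf_nonneg _ (x - 1)).trans_lt (strictMono_cdf_stdNormal (by linarith))

theorem cdf_stdNormal_lt_one (x : ℝ) : cdf stdNormal x < 1 :=
  (strictMono_cdf_stdNormal (by linarith : x < x + 1)).trans_le (cdf_le_one _ _)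

theorem exists_cdf_eq {μ : Measure ℝ} (hμ : Continuous (cdf μ)) {u : ℝ} (h0 : 0 < u) (h1 : u < 1) :
    ∃ x, cdf μ x = u := by
  obtain ⟨a, ha⟩ := ((tendsto_cdf_atBot μ).eventually_lt_const h0).exists
  obtain ⟨b, hb⟩ := ((tendsto_cdf_atTop μ).eventually_const_lt h1).exists
  exact mem_range_of_exists_le_of_exists_ge hμ ⟨a, ha.le⟩ ⟨b, hb.le⟩

theorem stdNormalQuantile_cdf (x : ℝ) : stdNormalQuantile (cdf stdNormal x) = x := by
  rw [stdNormalQuantile]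
  simp_rw [strictMono_cdf_stdNormal.le_iff_le]
  exact csInf_Ici

/-- Off `(0, 1)` the infimum is over the whole line or over the empty set, and the real `sInf` of
either is `0`. Hence the quantile function is the inverse of the distribution function extended by a
constant, which makes it measurable. -/
theorem stdNormalQuantile_of_notMem_range {u : ℝ} (hu : u ∉ Set.range (cdf stdNormal)) :
    stdNormalQuantile u = 0 := by
  rw [stdNormalQuantile]
  rcases le_or_gt u 0 with h | h
  · rw [show {x | u ≤ cdf (gaussianReal 0 1) x} = Set.univ from
      Set.eq_univ_of_forall fun x => h.trans (cdf_nonneg _ x), Real.sInf_univ]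
  · rcases lt_or_ge u 1 with h1 | h1
    · exact absurd (exists_cdf_eq continuous_cdf_stdNormal h h1) hu
    · rw [show {x | u ≤ cdf (gaussianReal 0 1) x} = ∅ from
        Set.eq_empty_of_forall_notMem fun x hx =>
          (cdf_stdNormal_lt_one x).not_ge (h1.trans hx), Real.sInf_empty]

theorem measurable_stdNormalQuantile : Measurable stdNormalQuantile := by
  have he : MeasurableEmbedding (cdf stdNormal) :=
    continuous_cdf_stdNormal.measurable.measurableEmbedding strictMono_cdf_stdNormal.injective
  have h : stdNormalQuantile = Function.extend (cdf stdNormal) id fun _ => 0 := by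
    funext u
    by_cases hu : u ∈ Set.range (cdf stdNormal)
    · obtain ⟨x, rfl⟩ := hu
      rw [stdNormalQuantile_cdf, strictMono_cdf_stdNormal.injective.extend_apply, id]
    · rw [stdNormalQuantile_of_notMem_range hu, Function.extend_apply' _ _ _ hu]
  rw [h]
  exact he.measurable_extend measurable_id measurable_const

/-- The transformation of a standard normal variable into one with law `μ`. -/
noncomputable def fromStdNormal (μ : Measure ℝ) (z : ℝ) : ℝ :=
  sInf {x | cdf stdNormal z ≤ cdf μ x}

/-- The transformation of a variable with law `μ` into a standard normal one. -/
noncomputable def toStdNormal (μ : Measure ℝ) (x : ℝ) : ℝ :=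
  stdNormalQuantile (cdf μ x)

theorem fromStdNormal_stdNormal : fromStdNormal stdNormal = id := by
  funext z
  exact stdNormalQuantile_cdf z

theorem measurable_toStdNormal (μ : Measure ℝ) : Measurable (toStdNormal μ) :=
  measurable_stdNormalQuantile.comp (monotone_cdf μ).measurable

section

variable {μ : Measure ℝ}

/-- Continuity of the distribution function makes the set closed, so its infimum is attained. -/
theorem isLeast_fromStdNormal (hμ : Continuous (cdf μ)) (z : ℝ) :
    IsLeast {x | cdf stdNormal z ≤ cdf μ x} (fromStdNormal μ z) := by
  have hne : {x | cdf stdNormal z ≤ cdf μ x}.Nonempty := by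
    obtain ⟨x, hx⟩ := exists_cdf_eq hμ (cdf_stdNormal_pos z) (cdf_stdNormal_lt_one z)
    exact ⟨x, hx.ge⟩
  have hbdd : BddBelow {x | cdf stdNormal z ≤ cdf μ x} := by
    obtain ⟨a, ha⟩ := ((tendsto_cdf_atBot μ).eventually_lt_const (cdf_stdNormal_pos z)).exists
    refine ⟨a, fun x hx => ?_⟩
    by_contra! h
    exact (monotone_cdf μ h.le).not_gt (ha.trans_le hx)
  exact (isClosed_le continuous_const hμ).isLeast_csInf hne hbdd

theorem fromStdNormal_le_iff (hμ : Continuous (cdf μ)) (z x : ℝ) :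
    fromStdNormal μ z ≤ x ↔ cdf stdNormal z ≤ cdf μ x :=
  ⟨fun h => (isLeast_fromStdNormal hμ z).1.trans (monotone_cdf μ h),
    fun h => (isLeast_fromStdNormal hμ z).2 h⟩

theorem cdf_fromStdNormal (hμ : Continuous (cdf μ)) (z : ℝ) :
    cdf μ (fromStdNormal μ z) = cdf stdNormal z := by
  obtain ⟨x, hx⟩ := exists_cdf_eq hμ (cdf_stdNormal_pos z) (cdf_stdNormal_lt_one z)
  refine le_antisymm ?_ (isLeast_fromStdNormal hμ z).1
  rw [← hx]
  exact monotone_cdf μ ((fromStdNormal_le_iff hμ z x).2 hx.ge)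

/-- This one-sided inverse holds even where `cdf μ` has flat pieces. It makes `fromStdNormal μ`
injective, which is all that the invariance of divergences requires. -/
theorem toStdNormal_fromStdNormal (hμ : Continuous (cdf μ)) (z : ℝ) :
    toStdNormal μ (fromStdNormal μ z) = z := by
  rw [toStdNormal, cdf_fromStdNormal hμ, stdNormalQuantile_cdf]

theorem measurable_fromStdNormal (hμ : Continuous (cdf μ)) : Measurable (fromStdNormal μ) := by
  refine Monotone.measurable fun z w hzw => (fromStdNormal_le_iff hμ _ _).2 ?_
  rw [cdf_fromStdNormal hμ]
  exact monotone_cdf _ hzw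

theorem map_fromStdNormal [IsProbabilityMeasure μ] (hμ : Continuous (cdf μ)) :
    stdNormal.map (fromStdNormal μ) = μ := by
  have hm := measurable_fromStdNormal hμ
  have := Measure.isProbabilityMeasure_map (μ := stdNormal) hm.aemeasurable
  refine Measure.eq_of_cdf _ _ (StieltjesFunction.ext fun x => ?_)
  rw [cdf_eq_real, Measure.real, Measure.map_apply hm measurableSet_Iic]
  have hset : fromStdNormal μ ⁻¹' Set.Iic x = {z | cdf stdNormal z ≤ cdf μ x} :=
    Set.ext fun z => fromStdNormal_le_iff hμ z x
  rw [hset]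
  -- The levels `0` and `1` may be attained by `cdf μ` but never by the normal distribution
  -- function, so they are treated apart.
  rcases (cdf_nonneg μ x).eq_or_lt with h0 | h0
  · rw [show {z | cdf stdNormal z ≤ cdf μ x} = ∅ from
      Set.eq_empty_of_forall_notMem fun z hz => (cdf_stdNormal_pos z).not_ge (h0 ▸ hz)]
    simpa using h0
  rcases (cdf_le_one μ x).eq_or_lt with h1 | h1
  · rw [show {z | cdf stdNormal z ≤ cdf μ x} = Set.univ from
      Set.eq_univ_of_forall fun z => (cdf_le_one _ z).trans h1.ge]
    simpa using h1.symm
  obtain ⟨w, hw⟩ := exists_cdf_eq continuous_cdf_stdNormal h0 h1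
  rw [← hw]
  simp_rw [strictMono_cdf_stdNormal.le_iff_le]
  exact (cdf_eq_real stdNormal w).symm

end

/-- The copula density at the distribution functions is `gaussianRatio S` evaluated at the normal
scores `toStdNormal (μ k) (x k)`; composed with the quantile transforms it becomes `gaussianRatio S`
itself. -/
theorem withDensity_gaussianCopulaDensity {d : ℕ} {μ : Fin d → Measure ℝ}
    [∀ k, IsProbabilityMeasure (μ k)] (hμ : ∀ k, Continuous (cdf (μ k)))
    (S : Matrix (Fin d) (Fin d) ℝ) :
    (Measure.pi μ).withDensity
        (fun x => ENNReal.ofReal (gaussianCopulaDensity S fun k => cdf (μ k) (x k))) =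
      ((Measure.pi fun _ : Fin d => stdNormal).withDensity
        fun x => ENNReal.ofReal (gaussianRatio S x)).map fun x k => fromStdNormal (μ k) (x k) := by
  have hm (k : Fin d) := measurable_fromStdNormal (hμ k)
  have hG : Measurable fun (x : Fin d → ℝ) k => fromStdNormal (μ k) (x k) :=
    measurable_pi_lambda _ fun k => (hm k).comp (measurable_pi_apply k)
  have hpi : Measure.pi μ = (Measure.pi fun _ : Fin d => stdNormal).map
      fun x k => fromStdNormal (μ k) (x k) := by
    have hp (k : Fin d) : IsProbabilityMeasure (stdNormal.map (fromStdNormal (μ k))) :=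
      Measure.isProbabilityMeasure_map (hm k).aemeasurable
    rw [Measure.pi_map_pi fun k => (hm k).aemeasurable]
    exact congrArg _ (funext fun k => (map_fromStdNormal (hμ k)).symm)
  have hZ : Measurable fun (x : Fin d → ℝ) k => toStdNormal (μ k) (x k) :=
    measurable_pi_lambda _ fun k => (measurable_toStdNormal _).comp (measurable_pi_apply k)
  have hr := (continuous_gaussianRatio S).measurable.ennreal_ofReal
  have hcomp : (fun x => ENNReal.ofReal (gaussianRatio S x)) =
      (fun x : Fin d → ℝ => ENNReal.ofReal (gaussianRatio S fun k => toStdNormal (μ k) (x k))) ∘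
        fun x k => fromStdNormal (μ k) (x k) := by
    funext x
    simp only [Function.comp_apply, toStdNormal_fromStdNormal (hμ _)]
  have hrZ : Measurable fun x : Fin d → ℝ =>
    ENNReal.ofReal (gaussianRatio S fun k => toStdNormal (μ k) (x k)) := hr.comp hZ
  rw [hcomp, map_withDensity_comp _ hG hrZ, ← hpi]
  rfl

/-! ### Pair laws of vectors with a Gaussian copula -/

theorem isProbabilityMeasure_marginal {d : ℕ} (P : Measure (Fin d → ℝ)) [IsProbabilityMeasure P]
    (k : Fin d) : IsProbabilityMeasure (marginal P k) :=
  Measure.isProbabilityMeasure_map (measurable_pi_apply k).aemeasurable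

theorem HasGaussianCopula.sq_lt_one {d : ℕ} {P : Measure (Fin d → ℝ)}
    {S : Matrix (Fin d) (Fin d) ℝ} (h : HasGaussianCopula P S) {i j : Fin d} (hij : i ≠ j) :
    (S i j) ^ 2 < 1 :=
  sq_lt_one_of_posDef h.posDef h.diag_eq_one hij

section

variable {d : ℕ} {P : Measure (Fin d → ℝ)} [IsProbabilityMeasure P]
  {S : Matrix (Fin d) (Fin d) ℝ}

theorem HasGaussianCopula.law_eq_map (h : HasGaussianCopula P S) :
    P = ((Measure.pi fun _ : Fin d => stdNormal).withDensity
      fun x => ENNReal.ofReal (gaussianRatio S x)).map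
        fun x k => fromStdNormal (marginal P k) (x k) := by
  have hp := isProbabilityMeasure_marginal P
  exact h.law_eq.trans (withDensity_gaussianCopulaDensity h.continuous_cdf S)

theorem HasGaussianCopula.pairLaw_eq (h : HasGaussianCopula P S) {i j : Fin d} (hij : i ≠ j) :
    pairLaw P i j = (stdNormalPlane.map (correlate (S i j))).map
      (Prod.map (fromStdNormal (marginal P i)) (fromStdNormal (marginal P j))) := by
  have hm (k : Fin d) := measurable_fromStdNormal (h.continuous_cdf k)
  have hG : Measurable fun (x : Fin d → ℝ) k => fromStdNormal (marginal P k) (x k) :=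
    measurable_pi_lambda _ fun k => (hm k).comp (measurable_pi_apply k)
  rw [← map_pair_withDensity_gaussianRatio h.posDef h.diag_eq_one i j (h.sq_lt_one hij),
    Measure.map_map ((hm i).prodMap (hm j)) (by fun_prop)]
  refine (congrArg (Measure.map fun x => (x i, x j)) h.law_eq_map).trans ?_
  rw [Measure.map_map (by fun_prop) hG]
  rfl

theorem HasGaussianCopula.pairProd_eq (h : HasGaussianCopula P S) (i j : Fin d) :
    pairProd P i j = stdNormalPlane.map
      (Prod.map (fromStdNormal (marginal P i)) (fromStdNormal (marginal P j))) := by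
  have hp := isProbabilityMeasure_marginal P
  rw [← Measure.map_prod_map _ _ (measurable_fromStdNormal (h.continuous_cdf i))
    (measurable_fromStdNormal (h.continuous_cdf j)), map_fromStdNormal (h.continuous_cdf i),
    map_fromStdNormal (h.continuous_cdf j)]
  rfl

end

/-! ### Invariance of `φ`-divergences under injective transforms -/

section

variable {α β : Type*} [MeasurableSpace α] [MeasurableSpace β]

open scoped Classical in
-- Since `G` is an embedding, the density `h` extends to a measurable function on the target, which
-- is the density of the image laws. Embeddings also transfer integrability of arbitrary functions,
-- so no regularity of `φ` enters.
theorem phiDiv_map_withDensity (φ : ℝ → ℝ) (μ : Measure α) [IsFiniteMeasure μ] {h : α → ℝ}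
    (hm : Measurable h) (h0 : ∀ x, 0 ≤ h x) {G : α → β} (hG : MeasurableEmbedding G) :
    phiDiv φ ((μ.withDensity fun x => ENNReal.ofReal (h x)).map G) (μ.map G) =
      if Integrable (fun x => φ (h x)) μ then ENNReal.ofReal (∫ x, φ (h x) ∂μ) else ∞ := by
  obtain ⟨h', hm', hh'⟩ := hG.exists_measurable_extend hm fun _ => ⟨0⟩
  have hd : (μ.withDensity fun x => ENNReal.ofReal (h x)).map G =
      (μ.map G).withDensity fun x => ENNReal.ofReal (h' x) := by
    rw [← map_withDensity_comp μ hG.measurable hm'.ennreal_ofReal, ← hh']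
    rfl
  have hae : (fun y => φ (((μ.map G).withDensity fun x => ENNReal.ofReal (h' x)).rnDeriv
      (μ.map G) y).toReal) =ᵐ[μ.map G] fun y => φ (ENNReal.ofReal (h' y)).toReal := by
    filter_upwards [Measure.rnDeriv_withDensity (μ.map G) hm'.ennreal_ofReal] with y hy
    rw [hy]
  have hcomp : (fun y => φ (ENNReal.ofReal (h' y)).toReal) ∘ G = fun x => φ (h x) := by
    funext x
    have : h' (G x) = h x := congrFun hh' x
    rw [Function.comp_apply, this, ENNReal.toReal_ofReal (h0 x)]
  have hint : ∫ y, φ (ENNReal.ofReal (h' y)).toReal ∂(μ.map G) = ∫ x, φ (h x) ∂μ := by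
    rw [hG.integral_map]
    exact congrArg (fun f => ∫ x, f x ∂μ) hcomp
  rw [phiDiv, hd, integrable_congr hae, integral_congr_ae hae, hG.integrable_map_iff, hcomp, hint]
  simp [withDensity_absolutelyContinuous]

/-- Here `klFun x = x log x + 1 - x`; for probability measures the affine part integrates to zero,
so this is the divergence of `x log x`. -/
theorem klDiv_eq_phiDiv (μ ν : Measure α) [IsFiniteMeasure μ] [IsFiniteMeasure ν] :
    InformationTheory.klDiv μ ν = phiDiv InformationTheory.klFun μ ν := by
  classical
  rw [InformationTheory.klDiv_eq_integral_klFun, phiDiv]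
  by_cases h : μ ≪ ν
  · simp only [h, true_and, InformationTheory.integrable_klFun_rnDeriv_iff h]
  · simp [h]

end

open scoped Classical in
/-- The `φ`-divergence between the centred bivariate normal law with unit variances and
correlation `ρ` and the standard normal law in the plane. -/
noncomputable def bivariateDiv (φ : ℝ → ℝ) (ρ : ℝ) : ℝ≥0∞ :=
  if Integrable (fun p => φ (bivariateRatio ρ p)) stdNormalPlane then
    ENNReal.ofReal (∫ p, φ (bivariateRatio ρ p) ∂stdNormalPlane) else ∞

/-- An injective measurable map between standard Borel spaces is an embedding (Lusin–Souslin). -/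
theorem measurableEmbedding_prodMap_fromStdNormal {μ ν : Measure ℝ} (hμ : Continuous (cdf μ))
    (hν : Continuous (cdf ν)) :
    MeasurableEmbedding (Prod.map (fromStdNormal μ) (fromStdNormal ν)) :=
  ((measurable_fromStdNormal hμ).prodMap (measurable_fromStdNormal hν)).measurableEmbedding
    (Function.Injective.prodMap (Function.LeftInverse.injective (toStdNormal_fromStdNormal hμ))
      (Function.LeftInverse.injective (toStdNormal_fromStdNormal hν)))

section

variable {d : ℕ} {P : Measure (Fin d → ℝ)} [IsProbabilityMeasure P]
  {S : Matrix (Fin d) (Fin d) ℝ}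

theorem HasGaussianCopula.dependence_phiDiv (h : HasGaussianCopula P S) {i j : Fin d}
    (hij : i ≠ j) (φ : ℝ → ℝ) : dependence (phiDiv φ) P i j = bivariateDiv φ (S i j) := by
  have hρ := h.sq_lt_one hij
  rw [dependence, h.pairLaw_eq hij, h.pairProd_eq, ← withDensity_bivariateRatio hρ,
    phiDiv_map_withDensity φ stdNormalPlane (continuous_bivariateRatio _).measurable
      (fun p => (bivariateRatio_pos hρ p).le)
      (measurableEmbedding_prodMap_fromStdNormal (h.continuous_cdf i) (h.continuous_cdf j))]
  rfl

theorem HasGaussianCopula.dependence_klDiv (h : HasGaussianCopula P S) {i j : Fin d}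
    (hij : i ≠ j) : dependence InformationTheory.klDiv P i j =
      bivariateDiv InformationTheory.klFun (S i j) := by
  have hp := isProbabilityMeasure_marginal P
  have : IsProbabilityMeasure (pairLaw P i j) :=
    Measure.isProbabilityMeasure_map (by fun_prop)
  have : IsProbabilityMeasure (pairProd P i j) := by
    unfold pairProd
    infer_instance
  rw [← h.dependence_phiDiv hij, dependence, dependence, klDiv_eq_phiDiv]

end

/-! ### Closed forms for KL, `χ²` and Hellinger -/

section

variable {ρ : ℝ}

/-- In the eigenbasis the exponent is diagonal, so any power of the ratio factors into two
one-dimensional exponentials. -/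
theorem bivariateRatio_correlate (hρ : ρ ^ 2 < 1) (p : ℝ × ℝ) :
    bivariateRatio ρ (correlate ρ p) =
      (Real.sqrt (1 - ρ ^ 2))⁻¹ * Real.exp (ρ / 2 * (p.1 ^ 2 - p.2 ^ 2)) := by
  have h : 0 < 1 - ρ ^ 2 := by linarith
  have h1 := Real.sq_sqrt (one_add_pos_of_sq_lt_one hρ).le
  have h2 := Real.sq_sqrt (one_sub_pos_of_sq_lt_one hρ).le
  have h3 := Real.sq_sqrt (zero_le_two (α := ℝ))
  rw [bivariateRatio, correlate]
  simp only [div_pow, div_mul_div_comm, ← sq (Real.sqrt 2), h3]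
  congr 2
  have e1 : (Real.sqrt (1 + ρ) * p.1 + Real.sqrt (1 - ρ) * p.2) ^ 2 =
      (1 + ρ) * p.1 ^ 2 + (1 - ρ) * p.2 ^ 2 +
        2 * (Real.sqrt (1 + ρ) * Real.sqrt (1 - ρ) * (p.1 * p.2)) := by
    linear_combination p.1 ^ 2 * h1 + p.2 ^ 2 * h2
  have e2 : (Real.sqrt (1 + ρ) * p.1 - Real.sqrt (1 - ρ) * p.2) ^ 2 =
      (1 + ρ) * p.1 ^ 2 + (1 - ρ) * p.2 ^ 2 -
        2 * (Real.sqrt (1 + ρ) * Real.sqrt (1 - ρ) * (p.1 * p.2)) := by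
    linear_combination p.1 ^ 2 * h1 + p.2 ^ 2 * h2
  have e3 : (Real.sqrt (1 + ρ) * p.1 + Real.sqrt (1 - ρ) * p.2) *
      (Real.sqrt (1 + ρ) * p.1 - Real.sqrt (1 - ρ) * p.2) =
      (1 + ρ) * p.1 ^ 2 - (1 - ρ) * p.2 ^ 2 := by
    linear_combination p.1 ^ 2 * h1 - p.2 ^ 2 * h2
  rw [e1, e2, e3]
  field_simp
  ring

theorem integrable_bivariateRatio_mul_iff (hρ : ρ ^ 2 < 1) {f : ℝ × ℝ → ℝ} (hf : Measurable f) :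
    Integrable (fun p => bivariateRatio ρ p * f p) stdNormalPlane ↔
      Integrable (fun p => f (correlate ρ p)) stdNormalPlane := by
  have h := integrable_map_measure (μ := stdNormalPlane) hf.aestronglyMeasurable
    (continuous_correlate ρ).measurable.aemeasurable
  rw [← withDensity_bivariateRatio hρ, integrable_withDensity_iff_integrable_smul'
    (measurable_bivariateRatio ρ) (by simp)] at h
  simpa [ENNReal.toReal_ofReal (bivariateRatio_pos hρ _).le, Function.comp_def] using h

theorem integral_bivariateRatio_mul (hρ : ρ ^ 2 < 1) {f : ℝ × ℝ → ℝ} (hf : Measurable f) :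
    ∫ p, bivariateRatio ρ p * f p ∂stdNormalPlane =
      ∫ p, f (correlate ρ p) ∂stdNormalPlane := by
  rw [← integral_map (continuous_correlate ρ).measurable.aemeasurable hf.aestronglyMeasurable,
    ← withDensity_bivariateRatio hρ, integral_withDensity_eq_integral_toReal_smul
    (measurable_bivariateRatio ρ) (by simp)]
  simp [ENNReal.toReal_ofReal (bivariateRatio_pos hρ _).le]

theorem integrable_bivariateRatio (hρ : ρ ^ 2 < 1) :
    Integrable (bivariateRatio ρ) stdNormalPlane := by
  simpa using (integrable_bivariateRatio_mul_iff hρ (f := fun _ => 1) (by fun_prop)).2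
    (integrable_const _)

/-- If `φ x = x * ψ x`, the `φ`-divergence is the mean of `ψ` of the density ratio. -/
theorem bivariateDiv_eq (hρ : ρ ^ 2 < 1) {φ ψ : ℝ → ℝ} (hψ : Measurable ψ)
    (hφ : ∀ x, 0 < x → φ x = x * ψ x)
    (hint : Integrable (fun p => ψ (bivariateRatio ρ (correlate ρ p))) stdNormalPlane) :
    bivariateDiv φ ρ =
      ENNReal.ofReal (∫ p, ψ (bivariateRatio ρ (correlate ρ p)) ∂stdNormalPlane) := by
  have h1 : (fun p => φ (bivariateRatio ρ p)) =
      fun p => bivariateRatio ρ p * ψ (bivariateRatio ρ p) :=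
    funext fun p => hφ _ (bivariateRatio_pos hρ p)
  have hm : Measurable fun p => ψ (bivariateRatio ρ p) :=
    hψ.comp (continuous_bivariateRatio ρ).measurable
  rw [bivariateDiv, h1, if_pos ((integrable_bivariateRatio_mul_iff hρ hm).2 hint),
    integral_bivariateRatio_mul hρ hm]

theorem integrable_exp_sq_sub_sq {t : ℝ} (ht : (2 * t) ^ 2 < 1) :
    Integrable (fun p : ℝ × ℝ => Real.exp (t * (p.1 ^ 2 - p.2 ^ 2))) stdNormalPlane := by
  have h := (integrable_exp_sq (t := t) (by nlinarith)).mul_prod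
    (integrable_exp_sq (t := -t) (by nlinarith))
  refine h.congr (Filter.Eventually.of_forall fun p => ?_)
  simp only [← Real.exp_add]
  ring_nf

theorem integral_exp_sq_sub_sq {t : ℝ} (ht : (2 * t) ^ 2 < 1) :
    ∫ p : ℝ × ℝ, Real.exp (t * (p.1 ^ 2 - p.2 ^ 2)) ∂stdNormalPlane =
      (Real.sqrt (1 - (2 * t) ^ 2))⁻¹ := by
  have h := integral_prod_mul (μ := stdNormal) (ν := stdNormal)
    (fun x => Real.exp (t * x ^ 2)) fun x => Real.exp (-t * x ^ 2)
  rw [integral_exp_sq (by nlinarith), integral_exp_sq (by nlinarith), ← mul_inv,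
    ← Real.sqrt_mul (by nlinarith)] at h
  rw [show 1 - (2 * t) ^ 2 = (1 - 2 * t) * (1 - 2 * -t) by ring, ← h]
  refine integral_congr_ae (Filter.Eventually.of_forall fun p => ?_)
  simp only [← Real.exp_add]
  ring_nf

theorem integrable_sq_fst : Integrable (fun p : ℝ × ℝ => p.1 ^ 2) stdNormalPlane :=
  integrable_sq_stdNormal.comp_fst _

theorem integrable_sq_snd : Integrable (fun p : ℝ × ℝ => p.2 ^ 2) stdNormalPlane :=
  integrable_sq_stdNormal.comp_snd _

theorem integral_sq_fst : ∫ p : ℝ × ℝ, p.1 ^ 2 ∂stdNormalPlane = 1 := by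
  rw [integral_fun_fst (fun x : ℝ => x ^ 2), integral_sq_stdNormal]
  simp

theorem integral_sq_snd : ∫ p : ℝ × ℝ, p.2 ^ 2 ∂stdNormalPlane = 1 := by
  rw [integral_fun_snd (fun x : ℝ => x ^ 2), integral_sq_stdNormal]
  simp

/-- Under the correlated law the ratio `R` has mean `(1 - ρ²)⁻¹` and `R⁻¹` has mean `1`. -/
theorem bivariateDiv_chiSq (hρ : ρ ^ 2 < 1) :
    bivariateDiv (fun x => x ^ 2 - 1) ρ = ENNReal.ofReal ((1 - ρ ^ 2)⁻¹ - 1) := by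
  have h : 0 < 1 - ρ ^ 2 := by linarith
  have hs : 0 < Real.sqrt (1 - ρ ^ 2) := Real.sqrt_pos.2 h
  have hss := Real.mul_self_sqrt h.le
  have hf : (fun p => bivariateRatio ρ (correlate ρ p) - (bivariateRatio ρ (correlate ρ p))⁻¹) =
      fun p => (Real.sqrt (1 - ρ ^ 2))⁻¹ * Real.exp (ρ / 2 * (p.1 ^ 2 - p.2 ^ 2)) -
        Real.sqrt (1 - ρ ^ 2) * Real.exp (-ρ / 2 * (p.1 ^ 2 - p.2 ^ 2)) := by
    funext p
    rw [bivariateRatio_correlate hρ, mul_inv, inv_inv, ← Real.exp_neg]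
    ring_nf
  have i1 := integrable_exp_sq_sub_sq (t := ρ / 2) (by linarith [sq (2 * (ρ / 2))])
  have i2 := integrable_exp_sq_sub_sq (t := -ρ / 2) (by linarith [sq (2 * (ρ / 2))])
  rw [bivariateDiv_eq hρ (ψ := fun x => x - x⁻¹) (by fun_prop)
    (fun x hx => by field_simp), hf]
  · rw [integral_sub (i1.const_mul _) (i2.const_mul _), integral_const_mul, integral_const_mul,
      integral_exp_sq_sub_sq (by linarith [sq (2 * (ρ / 2))]),
      integral_exp_sq_sub_sq (by linarith [sq (2 * (ρ / 2))]),
      show (2 * (ρ / 2)) ^ 2 = ρ ^ 2 by ring, show (2 * (-ρ / 2)) ^ 2 = ρ ^ 2 by ring,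
      mul_inv_cancel₀ hs.ne', ← mul_inv, hss]
  · rw [hf]
    exact (i1.const_mul _).sub (i2.const_mul _)

/-- The quadratic part of `log R` has mean zero because both coordinates have unit second moment,
and `R⁻¹ - 1` has mean zero; only the normalising constant remains. -/
theorem bivariateDiv_kl (hρ : ρ ^ 2 < 1) :
    bivariateDiv InformationTheory.klFun ρ = ENNReal.ofReal (-Real.log (1 - ρ ^ 2) / 2) := by
  have h : 0 < 1 - ρ ^ 2 := by linarith
  have hs : 0 < Real.sqrt (1 - ρ ^ 2) := Real.sqrt_pos.2 h
  have hf : (fun p => Real.log (bivariateRatio ρ (correlate ρ p)) +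
        (bivariateRatio ρ (correlate ρ p))⁻¹ - 1) =
      fun p => (-Real.log (1 - ρ ^ 2) / 2 - 1) + (ρ / 2 * (p.1 ^ 2 - p.2 ^ 2) +
        Real.sqrt (1 - ρ ^ 2) * Real.exp (-ρ / 2 * (p.1 ^ 2 - p.2 ^ 2))) := by
    funext p
    rw [bivariateRatio_correlate hρ, Real.log_mul (by positivity) (Real.exp_ne_zero _),
      Real.log_exp, Real.log_inv, Real.log_sqrt h.le, mul_inv, inv_inv, ← Real.exp_neg]
    ring_nf
  have i1 : Integrable (fun p : ℝ × ℝ => p.1 ^ 2 - p.2 ^ 2) stdNormalPlane :=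
    integrable_sq_fst.sub integrable_sq_snd
  have i2 := integrable_exp_sq_sub_sq (t := -ρ / 2) (by linarith [sq (2 * (ρ / 2))])
  have hi : Integrable (fun p : ℝ × ℝ => ρ / 2 * (p.1 ^ 2 - p.2 ^ 2) +
      Real.sqrt (1 - ρ ^ 2) * Real.exp (-ρ / 2 * (p.1 ^ 2 - p.2 ^ 2))) stdNormalPlane :=
    (i1.const_mul (ρ / 2)).add (i2.const_mul (Real.sqrt (1 - ρ ^ 2)))
  rw [bivariateDiv_eq hρ (ψ := fun x => Real.log x + x⁻¹ - 1) (by fun_prop)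
    (fun x hx => by rw [InformationTheory.klFun]; field_simp), hf]
  · rw [integral_add (integrable_const _) hi,
      integral_add (i1.const_mul _) (i2.const_mul _), integral_const_mul, integral_const_mul,
      integral_sub integrable_sq_fst integrable_sq_snd, integral_sq_fst, integral_sq_snd,
      integral_exp_sq_sub_sq (by linarith [sq (2 * (ρ / 2))]),
      show (2 * (-ρ / 2)) ^ 2 = ρ ^ 2 by ring, mul_inv_cancel₀ hs.ne']
    simp
  · rw [hf]
    exact (integrable_const _).add hi

theorem bivariateDiv_hellinger (hρ : ρ ^ 2 < 1) :
    bivariateDiv (fun x => (Real.sqrt x - 1) ^ 2) ρ =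
      ENNReal.ofReal (2 - 2 * (Real.sqrt (Real.sqrt (1 - ρ ^ 2)) /
        Real.sqrt (1 - ρ ^ 2 / 4))) := by
  have h : 0 < 1 - ρ ^ 2 := by linarith
  have hs : 0 < Real.sqrt (1 - ρ ^ 2) := Real.sqrt_pos.2 h
  have hf : (fun p => 1 - 2 * (Real.sqrt (bivariateRatio ρ (correlate ρ p)))⁻¹ +
        (bivariateRatio ρ (correlate ρ p))⁻¹) =
      fun p => 1 + (-2 * Real.sqrt (Real.sqrt (1 - ρ ^ 2)) *
          Real.exp (-ρ / 4 * (p.1 ^ 2 - p.2 ^ 2)) +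
        Real.sqrt (1 - ρ ^ 2) * Real.exp (-ρ / 2 * (p.1 ^ 2 - p.2 ^ 2))) := by
    funext p
    rw [bivariateRatio_correlate hρ, Real.sqrt_mul (by positivity), Real.sqrt_inv, mul_inv, mul_inv,
      inv_inv, inv_inv, ← Real.exp_neg, ← Real.exp_half, ← Real.exp_neg]
    ring_nf
  have i1 := integrable_exp_sq_sub_sq (t := -ρ / 4) (by nlinarith)
  have i2 := integrable_exp_sq_sub_sq (t := -ρ / 2) (by linarith [sq (2 * (ρ / 2))])
  have hi : Integrable (fun p : ℝ × ℝ => -2 * Real.sqrt (Real.sqrt (1 - ρ ^ 2)) *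
      Real.exp (-ρ / 4 * (p.1 ^ 2 - p.2 ^ 2)) + Real.sqrt (1 - ρ ^ 2) *
        Real.exp (-ρ / 2 * (p.1 ^ 2 - p.2 ^ 2))) stdNormalPlane :=
    (i1.const_mul (-2 * Real.sqrt (Real.sqrt (1 - ρ ^ 2)))).add
      (i2.const_mul (Real.sqrt (1 - ρ ^ 2)))
  rw [bivariateDiv_eq hρ (ψ := fun x => 1 - 2 * (Real.sqrt x)⁻¹ + x⁻¹) (by fun_prop)
    (fun x hx => by
      have h1 := Real.sq_sqrt hx.le
      have h2 : 0 < Real.sqrt x := Real.sqrt_pos.2 hx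
      field_simp
      linear_combination (Real.sqrt x - 2) * h1), hf]
  · rw [integral_add (integrable_const _) hi,
      integral_add (i1.const_mul _) (i2.const_mul _), integral_const_mul, integral_const_mul,
      integral_exp_sq_sub_sq (by nlinarith),
      integral_exp_sq_sub_sq (by linarith [sq (2 * (ρ / 2))]),
      show (2 * (-ρ / 2)) ^ 2 = ρ ^ 2 by ring, mul_inv_cancel₀ hs.ne',
      show (2 * (-ρ / 4)) ^ 2 = ρ ^ 2 / 4 by ring]
    congr 1
    simp
    ring
  · rw [hf]
    exact (integrable_const _).add hi

end

/-! ### Monotonicity for arbitrary convex `φ` -/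

theorem measurePreserving_mul_add_mul_stdNormal {c s : ℝ} (hcs : c ^ 2 + s ^ 2 = 1) :
    MeasurePreserving (fun p : ℝ × ℝ => c * p.1 + s * p.2) stdNormalPlane stdNormal := by
  refine ⟨by fun_prop, ?_⟩
  have h1 := gaussianReal_map_const_mul (μ := 0) (v := 1) c
  have h2 := gaussianReal_map_const_mul (μ := 0) (v := 1) s
  have h : stdNormalPlane.map (fun p : ℝ × ℝ => c * p.1 + s * p.2) =
      (stdNormal.map (c * ·)).conv (stdNormal.map (s * ·)) := by
    rw [Measure.conv, Measure.map_prod_map _ _ (by fun_prop) (by fun_prop),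
      Measure.map_map (by fun_prop) (by fun_prop)]
    rfl
  rw [h, h1, h2, gaussianReal_conv_gaussianReal]
  congr 1
  · simp
  · ext
    simpa using hcs

theorem measurePreserving_mehler {c s : ℝ} (hcs : c ^ 2 + s ^ 2 = 1) :
    MeasurePreserving (fun q : (ℝ × ℝ) × ℝ => (q.1.1, c * q.1.2 + s * q.2))
      (stdNormalPlane.prod stdNormal) stdNormalPlane :=
  ((MeasurePreserving.id stdNormal).prod (measurePreserving_mul_add_mul_stdNormal hcs)).comp
    (measurePreserving_prodAssoc stdNormal stdNormal stdNormal)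

section

variable {ρ c s : ℝ}

theorem bivariateRatio_mehler (hρ : ρ ^ 2 < 1) (c s x y z : ℝ) :
    bivariateRatio ρ (x, c * y + s * z) =
      ((Real.sqrt (1 - ρ ^ 2))⁻¹ * Real.exp (-(1 / 2) *
        ((ρ ^ 2 * x ^ 2 + ρ ^ 2 * (c * y) ^ 2 - 2 * ρ * (x * (c * y))) / (1 - ρ ^ 2)))) *
      Real.exp (-(ρ ^ 2 * s ^ 2 / (2 * (1 - ρ ^ 2))) * z ^ 2 +
        ((ρ * x - ρ ^ 2 * (c * y)) * s / (1 - ρ ^ 2)) * z) := by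
  have h : 1 - ρ ^ 2 ≠ 0 := by linarith
  rw [bivariateRatio, mul_assoc (Real.sqrt (1 - ρ ^ 2))⁻¹, ← Real.exp_add]
  congr 2
  field_simp
  ring

theorem integrable_bivariateRatio_mehler (hρ : ρ ^ 2 < 1) (c s x y : ℝ) :
    Integrable (fun z => bivariateRatio ρ (x, c * y + s * z)) stdNormal := by
  have h : 0 < 1 - ρ ^ 2 := by linarith
  simp_rw [bivariateRatio_mehler hρ]
  exact (integrable_exp_quadratic _ (by positivity)).const_mul _

/-- Adding noise to one coordinate multiplies the correlation by `c`. The averaged ratio is thus a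
conditional mean, to which Jensen's inequality applies. -/
theorem integral_bivariateRatio_mehler (hρ : ρ ^ 2 < 1) (hcs : c ^ 2 + s ^ 2 = 1) (x y : ℝ) :
    ∫ z, bivariateRatio ρ (x, c * y + s * z) ∂stdNormal = bivariateRatio (c * ρ) (x, y) := by
  have h : 0 < 1 - ρ ^ 2 := by linarith
  have hs : s ^ 2 = 1 - c ^ 2 := by linarith
  have hc : 0 < 1 - (c * ρ) ^ 2 := by
    nlinarith [mul_nonneg (sq_nonneg ρ) (sq_nonneg s)]
  have ha : 1 + 2 * (ρ ^ 2 * s ^ 2 / (2 * (1 - ρ ^ 2))) = (1 - (c * ρ) ^ 2) / (1 - ρ ^ 2) := by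
    rw [hs]
    field_simp
    ring
  simp_rw [bivariateRatio_mehler hρ]
  rw [integral_const_mul, integral_exp_quadratic _ (by positivity), ha, bivariateRatio,
    Real.sqrt_div hc.le]
  have h1 : Real.sqrt (1 - ρ ^ 2) ≠ 0 := (Real.sqrt_pos.2 h).ne'
  have h2 : Real.sqrt (1 - (c * ρ) ^ 2) ≠ 0 := (Real.sqrt_pos.2 hc).ne'
  rw [mul_mul_mul_comm, ← Real.exp_add]
  congr 1
  · field_simp
  · congr 1
    have h3 := h.ne'
    have h4 := hc.ne'
    generalize hD : 1 - (c * ρ) ^ 2 = D at *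
    have hE : ((ρ * x - ρ ^ 2 * (c * y)) * s / (1 - ρ ^ 2)) ^ 2 =
      (ρ * x - ρ ^ 2 * (c * y)) ^ 2 * (1 - c ^ 2) / (1 - ρ ^ 2) ^ 2 := by
      rw [div_pow, mul_pow, hs]
    rw [hE]
    field_simp
    rw [← hD]
    ring

end

/-- A convex function on an open interval has a supporting line at each point. -/
theorem ConvexOn.exists_supporting_line {φ : ℝ → ℝ} (hφ : ConvexOn ℝ (Set.Ioi 0) φ) {t : ℝ}
    (ht : 0 < t) : ∃ m : ℝ, ∀ u, 0 < u → φ t + m * (u - t) ≤ φ u := by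
  have hti : t ∈ interior (Set.Ioi (0 : ℝ)) := by rwa [interior_Ioi]
  refine ⟨derivWithin φ (Set.Ioi t) t, fun u hu => ?_⟩
  rcases lt_trichotomy u t with h | rfl | h
  · have h1 := (hφ.slope_le_leftDeriv_of_mem_interior hu hti h).trans
      (hφ.leftDeriv_le_rightDeriv_of_mem_interior hti)
    rw [slope_def_field, div_le_iff₀ (by linarith)] at h1
    linarith
  · simp
  · have h1 := hφ.rightDeriv_le_slope_of_mem_interior hti hu h
    rw [slope_def_field, le_div_iff₀ (by linarith)] at h1
    linarith

/-- The `φ`-divergence decreases if one of the two coordinates is replaced by a noisy one. -/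
theorem integral_convex_bivariateRatio_le {φ : ℝ → ℝ} (hφ : ConvexOn ℝ (Set.Ioi 0) φ)
    {ρ c : ℝ} (hρ : ρ ^ 2 < 1) (hc : c ^ 2 ≤ 1)
    (hint : Integrable (fun p => φ (bivariateRatio ρ p)) stdNormalPlane) :
    Integrable (fun p => φ (bivariateRatio (c * ρ) p)) stdNormalPlane ∧
      ∫ p, φ (bivariateRatio (c * ρ) p) ∂stdNormalPlane ≤
        ∫ p, φ (bivariateRatio ρ p) ∂stdNormalPlane := by
  obtain ⟨s, hcs⟩ : ∃ s : ℝ, c ^ 2 + s ^ 2 = 1 :=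
    ⟨Real.sqrt (1 - c ^ 2), by rw [Real.sq_sqrt (by linarith)]; ring⟩
  have hρ' : (c * ρ) ^ 2 < 1 := by
    rw [mul_pow]
    nlinarith [sq_nonneg ρ, sq_nonneg c]
  have hW := measurePreserving_mehler hcs
  have hWint : Integrable (fun q : (ℝ × ℝ) × ℝ =>
      φ (bivariateRatio ρ (q.1.1, c * q.1.2 + s * q.2))) (stdNormalPlane.prod stdNormal) :=
    hW.integrable_comp_of_integrable hint
  have hI := hWint.integral_prod_left
  have heq : ∫ p, ∫ z, φ (bivariateRatio ρ (p.1, c * p.2 + s * z)) ∂stdNormal ∂stdNormalPlane =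
      ∫ p, φ (bivariateRatio ρ p) ∂stdNormalPlane := by
    have h := integral_map hW.aemeasurable (f := fun p => φ (bivariateRatio ρ p))
      (hW.map_eq.symm ▸ hint.aestronglyMeasurable)
    rw [hW.map_eq] at h
    rw [← integral_prod _ hWint, h]
  -- Conditional Jensen: the supporting line is taken at the mean of the ratio over the noise, so
  -- its slope term integrates to zero.
  have hle : ∀ᵐ p ∂stdNormalPlane, φ (bivariateRatio (c * ρ) p) ≤
      ∫ z, φ (bivariateRatio ρ (p.1, c * p.2 + s * z)) ∂stdNormal := by
    filter_upwards [hWint.prod_right_ae] with p hp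
    obtain ⟨m, hm⟩ := hφ.exists_supporting_line (bivariateRatio_pos hρ' p)
    have hi := integrable_bivariateRatio_mehler hρ c s p.1 p.2
    have hsub : Integrable (fun z =>
        m * (bivariateRatio ρ (p.1, c * p.2 + s * z) - bivariateRatio (c * ρ) p)) stdNormal :=
      (hi.sub (integrable_const _)).const_mul m
    have hlin : Integrable (fun z => φ (bivariateRatio (c * ρ) p) +
        m * (bivariateRatio ρ (p.1, c * p.2 + s * z) - bivariateRatio (c * ρ) p)) stdNormal :=
      (integrable_const _).add hsub
    have h := integral_mono hlin hp fun z => hm _ (bivariateRatio_pos hρ _)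
    rwa [integral_add (integrable_const _) hsub,
      integral_const_mul, integral_sub hi (integrable_const _),
      integral_bivariateRatio_mehler hρ hcs, integral_const, integral_const, probReal_univ,
      one_smul, one_smul, sub_self, mul_zero, add_zero] at h
  have hcont : Continuous fun p => φ (bivariateRatio (c * ρ) p) :=
    (hφ.continuousOn isOpen_Ioi).comp_continuous (continuous_bivariateRatio _)
      fun p => bivariateRatio_pos hρ' p
  -- The function lies between an integrable affine function of the ratio, from the supporting line
  -- at `1`, and the integrable conditional mean.
  have hint' : Integrable (fun p => φ (bivariateRatio (c * ρ) p)) stdNormalPlane := by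
    obtain ⟨m, hm⟩ := hφ.exists_supporting_line one_pos
    have hlow : Integrable (fun p => φ 1 + m * (bivariateRatio (c * ρ) p - 1)) stdNormalPlane :=
      (integrable_const _).add
        (((integrable_bivariateRatio hρ').sub (integrable_const _)).const_mul m)
    refine (hI.norm.add hlow.norm).mono' hcont.aestronglyMeasurable ?_
    filter_upwards [hle] with p hp
    have h1 := hm _ (bivariateRatio_pos hρ' p)
    simp only [Pi.add_apply, Real.norm_eq_abs]
    rw [abs_le]
    constructor
    · linarith [neg_abs_le (φ 1 + m * (bivariateRatio (c * ρ) p - 1)),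
        abs_nonneg (∫ z, φ (bivariateRatio ρ (p.1, c * p.2 + s * z)) ∂stdNormal)]
    · linarith [abs_nonneg (φ 1 + m * (bivariateRatio (c * ρ) p - 1)),
        le_abs_self (∫ z, φ (bivariateRatio ρ (p.1, c * p.2 + s * z)) ∂stdNormal)]
  exact ⟨hint', heq ▸ integral_mono_ae hint' hI hle⟩

/-- The factor is `c = ρ / ρ'`, of either sign; for `ρ' = 0` both correlations vanish and `c = 0`
serves. -/
theorem bivariateDiv_mono {φ : ℝ → ℝ} (hφ : ConvexOn ℝ (Set.Ioi 0) φ) {ρ ρ' : ℝ}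
    (hρ' : ρ' ^ 2 < 1) (h : ρ ^ 2 ≤ ρ' ^ 2) : bivariateDiv φ ρ ≤ bivariateDiv φ ρ' := by
  obtain ⟨c, hc, rfl⟩ : ∃ c : ℝ, c ^ 2 ≤ 1 ∧ c * ρ' = ρ := by
    rcases eq_or_ne ρ' 0 with rfl | h0
    · exact ⟨0, by norm_num, by
        have : ρ ^ 2 = 0 := le_antisymm (by simpa using h) (sq_nonneg ρ)
        simpa using (pow_eq_zero_iff two_ne_zero).1 this |>.symm⟩
    · refine ⟨ρ / ρ', ?_, div_mul_cancel₀ _ h0⟩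
      rw [div_pow]
      exact div_le_one_of_le₀ h (sq_nonneg _)
  rw [bivariateDiv, bivariateDiv]
  split_ifs with h1 h2 h2
  · exact ENNReal.ofReal_le_ofReal (integral_convex_bivariateRatio_le hφ hρ' hc h2).2
  · exact le_top
  · exact absurd (integral_convex_bivariateRatio_le hφ hρ' hc h2).1 h1
  · exact le_rfl

/-! ### Maximum mean discrepancy of bivariate normal laws -/

/-- The map `correlate 0` is a reflection, not the identity. Writing the standard normal law as its
image puts both laws in the same eigenbasis. -/
theorem map_correlate_zero : stdNormalPlane.map (correlate 0) = stdNormalPlane := by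
  rw [← withDensity_bivariateRatio (by norm_num)]
  simp [bivariateRatio]

theorem sqDist_correlate (ρ σ : ℝ) (p q : ℝ × ℝ) :
    sqDist (correlate ρ p) (correlate σ q) =
      (Real.sqrt (1 + ρ) * p.1 - Real.sqrt (1 + σ) * q.1) ^ 2 +
        (Real.sqrt (1 - ρ) * p.2 - Real.sqrt (1 - σ) * q.2) ^ 2 := by
  have h := Real.sq_sqrt (zero_le_two (α := ℝ))
  simp only [sqDist, correlate]
  rw [← sub_div, ← sub_div, div_pow, div_pow, h]
  ring

theorem integral_exp_sq_sub_line {γ : ℝ} (hγ : 0 < γ) (a b x : ℝ) :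
    ∫ y, Real.exp (-γ * (a * x - b * y) ^ 2) ∂stdNormal =
      (Real.sqrt (1 + 2 * (γ * b ^ 2)))⁻¹ *
        Real.exp (-(γ * a ^ 2 / (1 + 2 * (γ * b ^ 2))) * x ^ 2) := by
  have h : 0 < 1 + 2 * (γ * b ^ 2) := by positivity
  have h1 (y : ℝ) : Real.exp (-γ * (a * x - b * y) ^ 2) = Real.exp (-γ * (a * x) ^ 2) *
      Real.exp (-(γ * b ^ 2) * y ^ 2 + (2 * γ * a * b * x) * y) := by
    rw [← Real.exp_add]
    ring_nf
  simp_rw [h1]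
  rw [integral_const_mul, integral_exp_quadratic _ h, mul_left_comm, ← Real.exp_add]
  congr 2
  field_simp
  ring

/-- For independent standard normal variables, `a x - b y` is centred normal with variance `a² +
b²`. -/
theorem integral_integral_exp_sq_sub {γ : ℝ} (hγ : 0 < γ) (a b : ℝ) :
    ∫ x, ∫ y, Real.exp (-γ * (a * x - b * y) ^ 2) ∂stdNormal ∂stdNormal =
      (Real.sqrt (1 + 2 * γ * (a ^ 2 + b ^ 2)))⁻¹ := by
  have h : 0 < 1 + 2 * (γ * b ^ 2) := by positivity
  have h2 : 0 < 1 + 2 * (γ * a ^ 2 / (1 + 2 * (γ * b ^ 2))) := by positivity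
  simp_rw [integral_exp_sq_sub_line hγ]
  have h3 := integral_exp_quadratic 0 h2
  simp only [zero_mul, add_zero, ne_eq, OfNat.ofNat_ne_zero, not_false_eq_true, zero_pow,
    zero_div, Real.exp_zero, mul_one] at h3
  rw [integral_const_mul, h3, ← mul_inv, ← Real.sqrt_mul h.le]
  congr 2
  field_simp
  ring

/-- Along the two eigenaxes the difference of the vectors has variances `2 + (ρ + σ)` and `2 - (ρ +
σ)`; the radicand is the product of `1 + 2γ` times each, plus nothing else: `(1 + 2γ(2 + ρ + σ)) (1
+ 2γ(2 - ρ - σ))`. -/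
theorem integral_gaussianKernel {γ : ℝ} (hγ : 0 < γ) {ρ σ : ℝ} (hρ : ρ ^ 2 < 1) (hσ : σ ^ 2 < 1) :
    ∫ p, gaussianKernel γ p.1 p.2 ∂((stdNormalPlane.map (correlate ρ)).prod
        (stdNormalPlane.map (correlate σ))) =
      (Real.sqrt ((1 + 4 * γ) ^ 2 - (2 * γ) ^ 2 * (ρ + σ) ^ 2))⁻¹ := by
  have hcρ := continuous_correlate ρ
  have hcσ := continuous_correlate σ
  have hk : Continuous fun p : (ℝ × ℝ) × (ℝ × ℝ) => gaussianKernel γ p.1 p.2 := by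
    unfold gaussianKernel sqDist
    fun_prop
  rw [Measure.map_prod_map _ _ hcρ.measurable hcσ.measurable,
    integral_map (hcρ.prodMap hcσ).measurable.aemeasurable hk.aestronglyMeasurable]
  have hF (q : (ℝ × ℝ) × (ℝ × ℝ)) : gaussianKernel γ (Prod.map (correlate ρ) (correlate σ) q).1
      (Prod.map (correlate ρ) (correlate σ) q).2 =
      Real.exp (-γ * (Real.sqrt (1 + ρ) * q.1.1 - Real.sqrt (1 + σ) * q.2.1) ^ 2) *
      Real.exp (-γ * (Real.sqrt (1 - ρ) * q.1.2 - Real.sqrt (1 - σ) * q.2.2) ^ 2) := by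
    rw [gaussianKernel, Prod.map_fst, Prod.map_snd, sqDist_correlate, ← Real.exp_add, mul_add]
  simp_rw [hF]
  rw [integral_prod]
  · have hin (p : ℝ × ℝ) : ∫ q : ℝ × ℝ,
        Real.exp (-γ * (Real.sqrt (1 + ρ) * p.1 - Real.sqrt (1 + σ) * q.1) ^ 2) *
        Real.exp (-γ * (Real.sqrt (1 - ρ) * p.2 - Real.sqrt (1 - σ) * q.2) ^ 2) ∂stdNormalPlane =
        (∫ y, Real.exp (-γ * (Real.sqrt (1 + ρ) * p.1 - Real.sqrt (1 + σ) * y) ^ 2) ∂stdNormal) *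
        ∫ y, Real.exp (-γ * (Real.sqrt (1 - ρ) * p.2 - Real.sqrt (1 - σ) * y) ^ 2) ∂stdNormal :=
      integral_prod_mul
        (fun y => Real.exp (-γ * (Real.sqrt (1 + ρ) * p.1 - Real.sqrt (1 + σ) * y) ^ 2))
        (fun y => Real.exp (-γ * (Real.sqrt (1 - ρ) * p.2 - Real.sqrt (1 - σ) * y) ^ 2))
    simp_rw [hin]
    rw [integral_prod_mul
      (fun x => ∫ y, Real.exp (-γ * (Real.sqrt (1 + ρ) * x - Real.sqrt (1 + σ) * y) ^ 2) ∂stdNormal)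
      (fun x => ∫ y, Real.exp (-γ * (Real.sqrt (1 - ρ) * x - Real.sqrt (1 - σ) * y) ^ 2) ∂stdNormal),
      integral_integral_exp_sq_sub hγ, integral_integral_exp_sq_sub hγ, ← mul_inv,
      ← Real.sqrt_mul (by positivity), Real.sq_sqrt (one_add_pos_of_sq_lt_one hρ).le,
      Real.sq_sqrt (one_add_pos_of_sq_lt_one hσ).le, Real.sq_sqrt (one_sub_pos_of_sq_lt_one hρ).le,
      Real.sq_sqrt (one_sub_pos_of_sq_lt_one hσ).le]
    congr 2
    ring
  · refine Integrable.mono' (integrable_const (1 : ℝ))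
      (by apply Continuous.aestronglyMeasurable; fun_prop)
      (Filter.Eventually.of_forall fun q => ?_)
    rw [← Real.exp_add, Real.norm_eq_abs, Real.abs_exp, Real.exp_le_one_iff]
    have h1 := mul_nonneg hγ.le
      (sq_nonneg (Real.sqrt (1 + ρ) * q.1.1 - Real.sqrt (1 + σ) * q.2.1))
    have h2 := mul_nonneg hγ.le
      (sq_nonneg (Real.sqrt (1 - ρ) * q.1.2 - Real.sqrt (1 - σ) * q.2.2))
    linarith

/-- The squared maximum mean discrepancy of a bivariate normal law with unit variances and
squared correlation `r` from the standard normal law in the plane. -/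
noncomputable def mmdSq (γ r : ℝ) : ℝ :=
  (Real.sqrt ((1 + 4 * γ) ^ 2 - 4 * (2 * γ) ^ 2 * r))⁻¹ + (1 + 4 * γ)⁻¹ -
    2 * (Real.sqrt ((1 + 4 * γ) ^ 2 - (2 * γ) ^ 2 * r))⁻¹

theorem gaussianMMD_correlate {γ : ℝ} (hγ : 0 < γ) {ρ : ℝ} (hρ : ρ ^ 2 < 1) :
    gaussianMMD γ (stdNormalPlane.map (correlate ρ)) stdNormalPlane =
      ENNReal.ofReal (Real.sqrt (mmdSq γ (ρ ^ 2))) := by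
  have h0 : (0 : ℝ) ^ 2 < 1 := by norm_num
  have h1 := integral_gaussianKernel hγ hρ hρ
  have h2 := integral_gaussianKernel hγ h0 h0
  have h3 := integral_gaussianKernel hγ hρ h0
  rw [map_correlate_zero] at h2 h3
  rw [gaussianMMD, h1, h2, h3, mmdSq]
  have h4 : Real.sqrt ((1 + 4 * γ) ^ 2 - (2 * γ) ^ 2 * (0 + 0) ^ 2) = 1 + 4 * γ := by
    rw [show (1 + 4 * γ) ^ 2 - (2 * γ) ^ 2 * (0 + 0) ^ 2 = (1 + 4 * γ) ^ 2 by ring,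
      Real.sqrt_sq (by positivity)]
  rw [h4, show (2 * γ) ^ 2 * (ρ + ρ) ^ 2 = 4 * (2 * γ) ^ 2 * ρ ^ 2 by ring, add_zero]

theorem inv_sqrt_sub_inv_sqrt {x y : ℝ} (hx : 0 < x) (hy : 0 < y) :
    (Real.sqrt y)⁻¹ - (Real.sqrt x)⁻¹ =
      (x - y) / (Real.sqrt x * Real.sqrt y * (Real.sqrt x + Real.sqrt y)) := by
  have h1 : 0 < Real.sqrt x := Real.sqrt_pos.2 hx
  have h2 : 0 < Real.sqrt y := Real.sqrt_pos.2 hy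
  field_simp
  linear_combination Real.sq_sqrt hx.le - Real.sq_sqrt hy.le

/-- Both inverse roots increase with `r`, with opposite signs in `mmdSq`. By `inv_sqrt_sub_inv_sqrt`
the positive increment wins: its numerator is `4` times the common factor against `2`, and its
smaller radicands give a smaller denominator. -/
theorem strictMonoOn_mmdSq {γ : ℝ} (hγ : 0 < γ) : StrictMonoOn (mmdSq γ) (Set.Ico 0 1) := by
  intro r hr r' hr' hlt
  have hb : 0 < (2 * γ) ^ 2 := by positivity
  have hpos (t : ℝ) (ht : t < 1) : 0 < (1 + 4 * γ) ^ 2 - 4 * (2 * γ) ^ 2 * t := by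
    nlinarith
  have hle (t : ℝ) (ht : 0 ≤ t) : (1 + 4 * γ) ^ 2 - 4 * (2 * γ) ^ 2 * t ≤
      (1 + 4 * γ) ^ 2 - (2 * γ) ^ 2 * t := by
    nlinarith [mul_nonneg hb.le ht]
  have p1 := hpos r hr.2
  have p2 := hpos r' hr'.2
  have q1 := hle r hr.1
  have q2 := hle r' hr'.1
  have e1 := inv_sqrt_sub_inv_sqrt p1 p2
  have e2 := inv_sqrt_sub_inv_sqrt (p1.trans_le q1) (p2.trans_le q2)
  have s1 := Real.sqrt_pos.2 p1
  have s2 := Real.sqrt_pos.2 p2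
  have key : 2 * (((2 * γ) ^ 2 * (r' - r)) /
      (Real.sqrt ((1 + 4 * γ) ^ 2 - (2 * γ) ^ 2 * r) *
        Real.sqrt ((1 + 4 * γ) ^ 2 - (2 * γ) ^ 2 * r') *
        (Real.sqrt ((1 + 4 * γ) ^ 2 - (2 * γ) ^ 2 * r) +
          Real.sqrt ((1 + 4 * γ) ^ 2 - (2 * γ) ^ 2 * r')))) <
      (4 * ((2 * γ) ^ 2 * (r' - r))) /
      (Real.sqrt ((1 + 4 * γ) ^ 2 - 4 * (2 * γ) ^ 2 * r) *
        Real.sqrt ((1 + 4 * γ) ^ 2 - 4 * (2 * γ) ^ 2 * r') *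
        (Real.sqrt ((1 + 4 * γ) ^ 2 - 4 * (2 * γ) ^ 2 * r) +
          Real.sqrt ((1 + 4 * γ) ^ 2 - 4 * (2 * γ) ^ 2 * r'))) := by
    have hd : 0 < (2 * γ) ^ 2 * (r' - r) := mul_pos hb (by linarith)
    rw [← mul_div_assoc]
    refine lt_of_le_of_lt ?_ (div_lt_div_of_pos_right (by linarith :
      2 * ((2 * γ) ^ 2 * (r' - r)) < 4 * ((2 * γ) ^ 2 * (r' - r))) (by positivity))
    gcongr
  rw [show (1 + 4 * γ) ^ 2 - 4 * (2 * γ) ^ 2 * r - ((1 + 4 * γ) ^ 2 - 4 * (2 * γ) ^ 2 * r') =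
    4 * ((2 * γ) ^ 2 * (r' - r)) by ring] at e1
  rw [show (1 + 4 * γ) ^ 2 - (2 * γ) ^ 2 * r - ((1 + 4 * γ) ^ 2 - (2 * γ) ^ 2 * r') =
    (2 * γ) ^ 2 * (r' - r) by ring] at e2
  rw [← e1, ← e2] at key
  simp only [mmdSq]
  linarith

theorem mmdSq_zero {γ : ℝ} (hγ : 0 < γ) : mmdSq γ 0 = 0 := by
  rw [mmdSq, mul_zero, mul_zero, sub_zero, Real.sqrt_sq (by positivity)]
  ring

/-! ### Wasserstein-2 distance of bivariate normal laws -/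

section Wasserstein

variable {ρ : ℝ}

theorem ofReal_integral_le_lintegral_ofReal {α : Type*} [MeasurableSpace α] {μ : Measure α}
    {f : α → ℝ} (hf : Integrable f μ) :
    ENNReal.ofReal (∫ x, f x ∂μ) ≤ ∫⁻ x, ENNReal.ofReal (f x) ∂μ := by
  rw [integral_eq_lintegral_pos_part_sub_lintegral_neg_part hf]
  exact (ENNReal.ofReal_le_ofReal (sub_le_self _ ENNReal.toReal_nonneg)).trans
    ENNReal.ofReal_toReal_le

/-- The quadratic form which is diagonal in the axes rotated by a quarter of a right angle. -/
noncomputable def diagonalForm (a b : ℝ) (p : ℝ × ℝ) : ℝ :=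
  a * ((p.1 + p.2) / Real.sqrt 2) ^ 2 + b * ((p.1 - p.2) / Real.sqrt 2) ^ 2

theorem continuous_diagonalForm (a b : ℝ) : Continuous (diagonalForm a b) := by
  unfold diagonalForm
  fun_prop

theorem diagonalForm_correlate (hρ : ρ ^ 2 < 1) (a b : ℝ) (p : ℝ × ℝ) :
    diagonalForm a b (correlate ρ p) = a * (1 + ρ) * p.1 ^ 2 + b * (1 - ρ) * p.2 ^ 2 := by
  have h := Real.mul_self_sqrt (zero_le_two (α := ℝ))
  have h1 := Real.sq_sqrt (one_add_pos_of_sq_lt_one hρ).le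
  have h2 := Real.sq_sqrt (one_sub_pos_of_sq_lt_one hρ).le
  simp only [diagonalForm, correlate]
  rw [← add_div, ← sub_div, div_div, div_div, h]
  linear_combination a * p.1 ^ 2 * h1 + b * p.2 ^ 2 * h2

theorem integrable_mul_sq_add_mul_sq (a b : ℝ) :
    Integrable (fun p : ℝ × ℝ => a * p.1 ^ 2 + b * p.2 ^ 2) stdNormalPlane :=
  (integrable_sq_fst.const_mul a).add (integrable_sq_snd.const_mul b)

theorem integral_mul_sq_add_mul_sq (a b : ℝ) :
    ∫ p : ℝ × ℝ, a * p.1 ^ 2 + b * p.2 ^ 2 ∂stdNormalPlane = a + b := by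
  rw [integral_add (integrable_sq_fst.const_mul a) (integrable_sq_snd.const_mul b),
    integral_const_mul, integral_const_mul, integral_sq_fst, integral_sq_snd, mul_one, mul_one]

theorem integrable_diagonalForm (hρ : ρ ^ 2 < 1) (a b : ℝ) :
    Integrable (diagonalForm a b) (stdNormalPlane.map (correlate ρ)) := by
  rw [integrable_map_measure (continuous_diagonalForm a b).aestronglyMeasurable
    (continuous_correlate ρ).measurable.aemeasurable]
  exact (integrable_mul_sq_add_mul_sq (a * (1 + ρ)) (b * (1 - ρ))).congr
    (Filter.Eventually.of_forall fun p => (diagonalForm_correlate hρ a b p).symm)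

theorem integral_diagonalForm (hρ : ρ ^ 2 < 1) (a b : ℝ) :
    ∫ p, diagonalForm a b p ∂(stdNormalPlane.map (correlate ρ)) =
      a * (1 + ρ) + b * (1 - ρ) := by
  rw [integral_map (continuous_correlate ρ).measurable.aemeasurable
    (continuous_diagonalForm a b).aestronglyMeasurable]
  simp_rw [diagonalForm_correlate hρ]
  exact integral_mul_sq_add_mul_sq _ _

/-- Kantorovich duality along one eigenaxis: the left side is a sum of potentials, with equality
exactly when `u = α v`, the optimal map that scales the standard deviation by `α`. -/
theorem mul_sq_add_mul_sq_le_sub_sq {α : ℝ} (hα : 0 < α) (u v : ℝ) :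
    (1 - α⁻¹) * u ^ 2 + (1 - α) * v ^ 2 ≤ (u - v) ^ 2 := by
  have h : (u - v) ^ 2 - ((1 - α⁻¹) * u ^ 2 + (1 - α) * v ^ 2) = α⁻¹ * (u - α * v) ^ 2 := by
    field_simp
    ring
  have : 0 ≤ α⁻¹ * (u - α * v) ^ 2 := by positivity
  linarith

theorem diagonalForm_add_diagonalForm_le {α β : ℝ} (hα : 0 < α) (hβ : 0 < β) (p q : ℝ × ℝ) :
    diagonalForm (1 - α⁻¹) (1 - β⁻¹) p + diagonalForm (1 - α) (1 - β) q ≤ sqDist p q := by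
  have h := Real.sq_sqrt (zero_le_two (α := ℝ))
  have h1 := mul_sq_add_mul_sq_le_sub_sq hα ((p.1 + p.2) / Real.sqrt 2)
    ((q.1 + q.2) / Real.sqrt 2)
  have h2 := mul_sq_add_mul_sq_le_sub_sq hβ ((p.1 - p.2) / Real.sqrt 2)
    ((q.1 - q.2) / Real.sqrt 2)
  have h3 : ((p.1 + p.2) / Real.sqrt 2 - (q.1 + q.2) / Real.sqrt 2) ^ 2 +
      ((p.1 - p.2) / Real.sqrt 2 - (q.1 - q.2) / Real.sqrt 2) ^ 2 = sqDist p q := by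
    rw [← sub_div, ← sub_div, div_pow, div_pow, h, sqDist]
    ring
  rw [← h3, diagonalForm, diagonalForm]
  linarith

theorem wasserstein2_correlate (hρ : ρ ^ 2 < 1) :
    wasserstein2 (stdNormalPlane.map (correlate ρ)) stdNormalPlane =
      ENNReal.ofReal (4 - 2 * Real.sqrt (2 + 2 * Real.sqrt (1 - ρ ^ 2))) ^ (1 / 2 : ℝ) := by
  have hp := one_add_pos_of_sq_lt_one hρ
  have hm := one_sub_pos_of_sq_lt_one hρ
  have hα := Real.sqrt_pos.2 hp
  have hβ := Real.sqrt_pos.2 hm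
  have h1 := Real.sq_sqrt hp.le
  have h2 := Real.sq_sqrt hm.le
  have hsum : Real.sqrt (2 + 2 * Real.sqrt (1 - ρ ^ 2)) = Real.sqrt (1 + ρ) + Real.sqrt (1 - ρ) := by
    rw [Real.sqrt_eq_iff_mul_self_eq (by positivity) (by positivity),
      show 1 - ρ ^ 2 = (1 + ρ) * (1 - ρ) by ring, Real.sqrt_mul hp.le]
    linear_combination -h1 - h2
  set α := Real.sqrt (1 + ρ)
  set β := Real.sqrt (1 - ρ)
  rw [wasserstein2, hsum]
  congr 1
  have hcρ := (continuous_correlate ρ).measurable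
  have hc0 := (continuous_correlate 0).measurable
  have hsq : Measurable fun p : (ℝ × ℝ) × (ℝ × ℝ) => ENNReal.ofReal (sqDist p.1 p.2) := by
    unfold sqDist
    fun_prop
  refine le_antisymm ?_ (le_iInf fun π => le_iInf fun hπ1 => le_iInf fun hπ2 => ?_)
  · have hpair := hcρ.prodMk hc0
    -- The upper bound couples the laws through one standard normal vector. Its cost is `(α - 1)² +
    -- (β - 1)² = 4 - 2 (α + β)`, as `α² + β² = 2`.
    refine (iInf_le _ (stdNormalPlane.map fun p => (correlate ρ p, correlate 0 p))).trans
      ((iInf_le _ ?_).trans ((iInf_le _ ?_).trans ?_))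
    · rw [Measure.map_map measurable_fst hpair]
      rfl
    · rw [Measure.map_map measurable_snd hpair]
      exact map_correlate_zero
    · rw [lintegral_map hsq hpair]
      have hd (p : ℝ × ℝ) : sqDist (correlate ρ p) (correlate 0 p) =
          (α - 1) ^ 2 * p.1 ^ 2 + (β - 1) ^ 2 * p.2 ^ 2 := by
        rw [sqDist_correlate, add_zero, sub_zero, Real.sqrt_one]
        ring
      simp_rw [hd]
      rw [← ofReal_integral_eq_lintegral_ofReal (integrable_mul_sq_add_mul_sq _ _)
        (Filter.Eventually.of_forall fun p => by positivity), integral_mul_sq_add_mul_sq]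
      refine ENNReal.ofReal_le_ofReal (le_of_eq ?_)
      linear_combination h1 + h2
  -- The lower bound integrates the dual potentials. They depend only on the marginals of the
  -- coupling `π`, and their total is again `4 - 2 (α + β)`.
  · have hf := integrable_diagonalForm hρ (1 - α⁻¹) (1 - β⁻¹)
    have hg := integrable_diagonalForm (ρ := 0) (by norm_num) (1 - α) (1 - β)
    have hfi := integral_diagonalForm hρ (1 - α⁻¹) (1 - β⁻¹)
    have hgi := integral_diagonalForm (ρ := 0) (by norm_num) (1 - α) (1 - β)
    rw [map_correlate_zero, ← hπ2] at hg hgi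
    rw [← hπ1] at hf hfi
    rw [integral_map measurable_fst.aemeasurable
      (continuous_diagonalForm _ _).aestronglyMeasurable] at hfi
    rw [integral_map measurable_snd.aemeasurable
      (continuous_diagonalForm _ _).aestronglyMeasurable] at hgi
    have hf' := hf.comp_measurable measurable_fst
    have hg' := hg.comp_measurable measurable_snd
    have hval : ∫ p, diagonalForm (1 - α⁻¹) (1 - β⁻¹) p.1 + diagonalForm (1 - α) (1 - β) p.2 ∂π =
        4 - 2 * (α + β) := by
      have := integral_add hf' hg'
      simp only [Function.comp_apply] at this
      rw [this, hfi, hgi]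
      have ha : α⁻¹ * (1 + ρ) = α := by rw [← h1, sq, inv_mul_cancel_left₀ hα.ne']
      have hb : β⁻¹ * (1 - ρ) = β := by rw [← h2, sq, inv_mul_cancel_left₀ hβ.ne']
      linear_combination -ha - hb
    rw [← hval]
    exact (ofReal_integral_le_lintegral_ofReal (hf'.add hg')).trans
      (lintegral_mono fun p =>
        ENNReal.ofReal_le_ofReal (diagonalForm_add_diagonalForm_le hα hβ p.1 p.2))

end Wasserstein

/-! ### From monotone dependence to copula distances -/

section

variable {d : ℕ} {H : Measure (ℝ × ℝ) → Measure (ℝ × ℝ) → ℝ≥0∞} {P P' Q : Measure (Fin d → ℝ)}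
  {i j : Fin d}

theorem copulaDist_of_le (h : dependence H Q i j ≤ dependence H P i j) :
    copulaDist H P Q i j = dependence H P i j - dependence H Q i j := by
  rw [copulaDist, tsub_eq_zero_of_le h, max_eq_left zero_le]

theorem copulaDist_of_ge (h : dependence H P i j ≤ dependence H Q i j) :
    copulaDist H P Q i j = dependence H Q i j - dependence H P i j := by
  rw [copulaDist, tsub_eq_zero_of_le h, max_eq_right zero_le]

/-- The copula distance is monotone in the gap between squared correlations if the dependence is
monotone in the squared correlation. -/
theorem copulaDist_le_copulaDist {D : ℝ → ℝ≥0∞} (hD : MonotoneOn D (Set.Ico 0 1)) {r r' s : ℝ}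
    (hr : r ∈ Set.Ico (0 : ℝ) 1) (hr' : r' ∈ Set.Ico (0 : ℝ) 1) (hs : s ∈ Set.Ico (0 : ℝ) 1)
    (hside : (s ≤ r ∧ s ≤ r') ∨ (r ≤ s ∧ r' ≤ s)) (hP : dependence H P i j = D r)
    (hP' : dependence H P' i j = D r') (hQ : dependence H Q i j = D s)
    (hgap : |r - s| ≤ |r' - s|) : copulaDist H P Q i j ≤ copulaDist H P' Q i j := by
  rcases hside with ⟨h, h'⟩ | ⟨h, h'⟩
  · rw [abs_of_nonneg (sub_nonneg.2 h), abs_of_nonneg (sub_nonneg.2 h')] at hgap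
    have hle := hD hr hr' (by linarith)
    rw [copulaDist_of_le (by rw [hP, hQ]; exact hD hs hr h),
      copulaDist_of_le (by rw [hP', hQ]; exact hD hs hr' h'), hP, hP', hQ]
    exact tsub_le_tsub_right hle _
  · rw [abs_of_nonpos (sub_nonpos.2 h), abs_of_nonpos (sub_nonpos.2 h')] at hgap
    have hle := hD hr' hr (by linarith)
    rw [copulaDist_of_ge (by rw [hP, hQ]; exact hD hr hs h),
      copulaDist_of_ge (by rw [hP', hQ]; exact hD hr' hs h'), hP, hP', hQ]
    exact tsub_le_tsub_left hle _

/-- Finiteness of `D` matters because subtraction in `[0, ∞]` preserves strict inequalities only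
when the terms can be cancelled. -/
theorem copulaDist_lt_copulaDist {D : ℝ → ℝ≥0∞} (hD : StrictMonoOn D (Set.Ico 0 1))
    (hfin : ∀ r ∈ Set.Ico (0 : ℝ) 1, D r ≠ ∞) {r r' s : ℝ}
    (hr : r ∈ Set.Ico (0 : ℝ) 1) (hr' : r' ∈ Set.Ico (0 : ℝ) 1) (hs : s ∈ Set.Ico (0 : ℝ) 1)
    (hside : (s ≤ r ∧ s ≤ r') ∨ (r ≤ s ∧ r' ≤ s)) (hP : dependence H P i j = D r)
    (hP' : dependence H P' i j = D r') (hQ : dependence H Q i j = D s)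
    (hgap : |r - s| < |r' - s|) : copulaDist H P Q i j < copulaDist H P' Q i j := by
  have hm := hD.monotoneOn
  rcases hside with ⟨h, h'⟩ | ⟨h, h'⟩
  · rw [abs_of_nonneg (sub_nonneg.2 h), abs_of_nonneg (sub_nonneg.2 h')] at hgap
    have hlt := hD hr hr' (by linarith)
    rw [copulaDist_of_le (by rw [hP, hQ]; exact hm hs hr h),
      copulaDist_of_le (by rw [hP', hQ]; exact hm hs hr' h'), hP, hP', hQ]
    exact (ENNReal.cancel_of_ne (hfin s hs)).tsub_lt_tsub_right_of_le (hm hs hr h) hlt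
  · rw [abs_of_nonpos (sub_nonpos.2 h), abs_of_nonpos (sub_nonpos.2 h')] at hgap
    have hlt := hD hr' hr (by linarith)
    rw [copulaDist_of_ge (by rw [hP, hQ]; exact hm hr hs h),
      copulaDist_of_ge (by rw [hP', hQ]; exact hm hr' hs h'), hP, hP', hQ]
    exact (ENNReal.cancel_of_ne (ENNReal.sub_ne_top (hfin s hs))).tsub_lt_tsub_left_of_le
      (hm hr hs h) hlt

theorem copulaDistIncreases_of_strictMonoOn {D : ℝ → ℝ≥0∞} (hD : StrictMonoOn D (Set.Ico 0 1))
    (hfin : ∀ r ∈ Set.Ico (0 : ℝ) 1, D r ≠ ∞) {r r' s : ℝ}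
    (hr : r ∈ Set.Ico (0 : ℝ) 1) (hr' : r' ∈ Set.Ico (0 : ℝ) 1) (hs : s ∈ Set.Ico (0 : ℝ) 1)
    (hside : (s ≤ r ∧ s ≤ r') ∨ (r ≤ s ∧ r' ≤ s)) (hP : dependence H P i j = D r)
    (hP' : dependence H P' i j = D r') (hQ : dependence H Q i j = D s) :
    CopulaDistIncreases H P P' Q i j |r - s| |r' - s| :=
  ⟨hP ▸ hfin r hr, hP' ▸ hfin r' hr', hQ ▸ hfin s hs,
    copulaDist_le_copulaDist hD.monotoneOn hr hr' hs hside hP hP' hQ,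
    copulaDist_lt_copulaDist hD hfin hr hr' hs hside hP hP' hQ⟩

end

/-! ### Strict monotonicity of the closed forms -/

theorem strictMonoOn_ofReal {f : ℝ → ℝ} {s : Set ℝ} (hf : StrictMonoOn f s)
    (h0 : ∀ r ∈ s, 0 ≤ f r) : StrictMonoOn (fun r => ENNReal.ofReal (f r)) s :=
  fun r hr _ hr' h => (ENNReal.ofReal_lt_ofReal_iff ((h0 r hr).trans_lt (hf hr hr' h))).2
    (hf hr hr' h)

theorem strictMonoOn_ofReal_of_zero {f : ℝ → ℝ} (hf : StrictMonoOn f (Set.Ico 0 1))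
    (h0 : f 0 = 0) : StrictMonoOn (fun r => ENNReal.ofReal (f r)) (Set.Ico 0 1) :=
  strictMonoOn_ofReal hf fun _ hr =>
    h0 ▸ hf.monotoneOn (Set.left_mem_Ico.2 one_pos) hr hr.1

theorem strictMonoOn_kl : StrictMonoOn (fun r : ℝ => -Real.log (1 - r) / 2) (Set.Ico 0 1) := by
  intro r hr r' hr' h
  have := Real.log_lt_log (by linarith [hr'.2] : 0 < 1 - r') (by linarith : 1 - r' < 1 - r)
  simp only
  linarith

theorem strictMonoOn_chiSq : StrictMonoOn (fun r : ℝ => (1 - r)⁻¹ - 1) (Set.Ico 0 1) := by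
  intro r hr r' hr' h
  have : (1 - r)⁻¹ < (1 - r')⁻¹ := inv_strictAnti₀ (by linarith [hr'.2]) (by linarith)
  simp only
  linarith

theorem strictMonoOn_hellinger :
    StrictMonoOn (fun r : ℝ => 2 - 2 * (Real.sqrt (Real.sqrt (1 - r)) / Real.sqrt (1 - r / 4)))
      (Set.Ico 0 1) := by
  intro r hr r' hr' h
  have h1 : 0 < 1 - r := by linarith [hr.2]
  have h1' : 0 < 1 - r' := by linarith [hr'.2]
  have h2 : 0 < 1 - r / 4 := by linarith
  have h2' : 0 < 1 - r' / 4 := by linarith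
  have hq (t : ℝ) (ht : 0 < 1 - t / 4) : Real.sqrt (Real.sqrt (1 - t)) / Real.sqrt (1 - t / 4) =
      Real.sqrt (Real.sqrt ((1 - t) / (1 - t / 4) ^ 2)) := by
    rw [Real.sqrt_div' _ (sq_nonneg _), Real.sqrt_sq ht.le, Real.sqrt_div' _ ht.le]
  -- The fourth power of the Hellinger affinity is a rational function of `r`, so its decrease is a
  -- polynomial inequality.
  have hlt : (1 - r') / (1 - r' / 4) ^ 2 < (1 - r) / (1 - r / 4) ^ 2 := by
    rw [div_lt_div_iff₀ (by positivity) (by positivity)]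
    have hr0 := hr.1
    have hrr : r * r' ≤ 1 := by nlinarith [hr.1, hr.2, hr'.1, hr'.2]
    have : (1 - r) * (1 - r' / 4) ^ 2 - (1 - r') * (1 - r / 4) ^ 2 =
      (r' - r) * (8 + (r + r') - r * r') / 16 := by ring
    have h3 : 0 < (r' - r) * (8 + (r + r') - r * r') :=
      mul_pos (by linarith) (by linarith [hr'.1])
    linarith
  have := Real.sqrt_lt_sqrt (Real.sqrt_nonneg _) (Real.sqrt_lt_sqrt (by positivity) hlt)
  simp only
  rw [hq r h2, hq r' h2']
  linarith

theorem strictMonoOn_wasserstein2 :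
    StrictMonoOn (fun r : ℝ => 4 - 2 * Real.sqrt (2 + 2 * Real.sqrt (1 - r))) (Set.Ico 0 1) := by
  intro r hr r' hr' h
  have h1 := Real.sqrt_lt_sqrt (by linarith [hr'.2] : 0 ≤ 1 - r') (by linarith : 1 - r' < 1 - r)
  have h2 := Real.sqrt_lt_sqrt (by positivity : 0 ≤ 2 + 2 * Real.sqrt (1 - r'))
    (by linarith : 2 + 2 * Real.sqrt (1 - r') < 2 + 2 * Real.sqrt (1 - r))
  simp only
  linarith

/-! ### Proof of the proposition -/

section

variable {d : ℕ} {P : Measure (Fin d → ℝ)} [IsProbabilityMeasure P]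
  {S : Matrix (Fin d) (Fin d) ℝ}

/-- For standard normal marginals the quantile transforms are the identity, so this reduction holds
for any `H`, including distances that are not invariant under coordinate transforms. -/
theorem HasGaussianCopula.dependence_of_stdNormal (h : HasGaussianCopula P S) {i j : Fin d}
    (hij : i ≠ j) (hi : marginal P i = stdNormal) (hj : marginal P j = stdNormal)
    (H : Measure (ℝ × ℝ) → Measure (ℝ × ℝ) → ℝ≥0∞) :
    dependence H P i j = H (stdNormalPlane.map (correlate (S i j))) stdNormalPlane := by
  rw [dependence, h.pairLaw_eq hij, h.pairProd_eq, hi, hj, fromStdNormal_stdNormal, Prod.map_id,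
    Measure.map_id, Measure.map_id]

end

theorem proposition2 {d : ℕ} (i j : Fin d) (hij : i < j)
    (PX PX' PY : Measure (Fin d → ℝ)) [IsProbabilityMeasure PX] [IsProbabilityMeasure PX']
    [IsProbabilityMeasure PY] (SX SX' SY : Matrix (Fin d) (Fin d) ℝ)
    (hX : HasGaussianCopula PX SX) (hX' : HasGaussianCopula PX' SX')
    (hY : HasGaussianCopula PY SY)
    (hside : ((SY i j) ^ 2 ≤ (SX i j) ^ 2 ∧ (SY i j) ^ 2 ≤ (SX' i j) ^ 2) ∨
      ((SX i j) ^ 2 ≤ (SY i j) ^ 2 ∧ (SX' i j) ^ 2 ≤ (SY i j) ^ 2)) :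
    CopulaDistIncreases InformationTheory.klDiv PX PX' PY i j
      (sqGap SX SY i j) (sqGap SX' SY i j) ∧
    CopulaDistIncreases (phiDiv fun x => x ^ 2 - 1) PX PX' PY i j
      (sqGap SX SY i j) (sqGap SX' SY i j) ∧
    CopulaDistIncreases (phiDiv fun x => (Real.sqrt x - 1) ^ 2) PX PX' PY i j
      (sqGap SX SY i j) (sqGap SX' SY i j) ∧
    (∀ φ : ℝ → ℝ, ConvexOn ℝ (Set.Ioi 0) φ → φ 1 = 0 →
      dependence (phiDiv φ) PY i j ≠ ∞ → sqGap SX SY i j ≤ sqGap SX' SY i j →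
      copulaDist (phiDiv φ) PX PY i j ≤ copulaDist (phiDiv φ) PX' PY i j) ∧
    ((∀ P ∈ ({PX, PX', PY} : Set (Measure (Fin d → ℝ))),
        marginal P i = gaussianReal 0 1 ∧ marginal P j = gaussianReal 0 1) →
      CopulaDistIncreases wasserstein2 PX PX' PY i j
        (sqGap SX SY i j) (sqGap SX' SY i j) ∧
      ∀ γ : ℝ, 0 < γ → CopulaDistIncreases (gaussianMMD γ) PX PX' PY i j
        (sqGap SX SY i j) (sqGap SX' SY i j)) := by
  have hne := hij.ne
  have hr := hX.sq_lt_one hne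
  have hr' := hX'.sq_lt_one hne
  have hs := hY.sq_lt_one hne
  have mr : (SX i j) ^ 2 ∈ Set.Ico (0 : ℝ) 1 := ⟨sq_nonneg _, hr⟩
  have mr' : (SX' i j) ^ 2 ∈ Set.Ico (0 : ℝ) 1 := ⟨sq_nonneg _, hr'⟩
  have ms : (SY i j) ^ 2 ∈ Set.Ico (0 : ℝ) 1 := ⟨sq_nonneg _, hs⟩
  refine ⟨?_, ?_, ?_, fun φ hφ _ _ hgap => ?_, fun hstd => ⟨?_, fun γ hγ => ?_⟩⟩
  · exact copulaDistIncreases_of_strictMonoOn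
      (strictMonoOn_ofReal_of_zero strictMonoOn_kl (by simp)) (fun _ _ => ENNReal.ofReal_ne_top)
      mr mr' ms hside ((hX.dependence_klDiv hne).trans (bivariateDiv_kl hr))
      ((hX'.dependence_klDiv hne).trans (bivariateDiv_kl hr'))
      ((hY.dependence_klDiv hne).trans (bivariateDiv_kl hs))
  · exact copulaDistIncreases_of_strictMonoOn
      (strictMonoOn_ofReal_of_zero strictMonoOn_chiSq (by simp)) (fun _ _ => ENNReal.ofReal_ne_top)
      mr mr' ms hside ((hX.dependence_phiDiv hne _).trans (bivariateDiv_chiSq hr))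
      ((hX'.dependence_phiDiv hne _).trans (bivariateDiv_chiSq hr'))
      ((hY.dependence_phiDiv hne _).trans (bivariateDiv_chiSq hs))
  · exact copulaDistIncreases_of_strictMonoOn
      (strictMonoOn_ofReal_of_zero strictMonoOn_hellinger (by simp))
      (fun _ _ => ENNReal.ofReal_ne_top)
      mr mr' ms hside ((hX.dependence_phiDiv hne _).trans (bivariateDiv_hellinger hr))
      ((hX'.dependence_phiDiv hne _).trans (bivariateDiv_hellinger hr'))
      ((hY.dependence_phiDiv hne _).trans (bivariateDiv_hellinger hs))
  -- The dependence must be a function of `r = ρ²`, so `ρ` is replaced by `√(ρ²)`; monotonicity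
  -- applied in both directions to equal squares shows that the sign is immaterial.
  · have hD (ρ : ℝ) (hρ : ρ ^ 2 < 1) :
        bivariateDiv φ ρ = bivariateDiv φ (Real.sqrt (ρ ^ 2)) := by
      have hsq : Real.sqrt (ρ ^ 2) ^ 2 = ρ ^ 2 := Real.sq_sqrt (sq_nonneg ρ)
      exact le_antisymm (bivariateDiv_mono hφ (hsq.trans_lt hρ) hsq.ge) (bivariateDiv_mono hφ hρ hsq.le)
    have hmono : MonotoneOn (fun r => bivariateDiv φ (Real.sqrt r)) (Set.Ico 0 1) := by
      intro r hr r' hr' h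
      refine bivariateDiv_mono hφ ?_ ?_ <;> rw [Real.sq_sqrt hr'.1]
      · exact hr'.2
      · rwa [Real.sq_sqrt hr.1]
    exact copulaDist_le_copulaDist hmono mr mr' ms hside
      ((hX.dependence_phiDiv hne φ).trans (hD _ hr))
      ((hX'.dependence_phiDiv hne φ).trans (hD _ hr'))
      ((hY.dependence_phiDiv hne φ).trans (hD _ hs)) hgap
  all_goals
    obtain ⟨hXi, hXj⟩ := hstd PX (by simp)
    obtain ⟨hXi', hXj'⟩ := hstd PX' (by simp)
    obtain ⟨hYi, hYj⟩ := hstd PY (by simp)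
  · have hsqrt : Real.sqrt (2 + 2 * Real.sqrt (1 - 0)) = 2 := by
      rw [sub_zero, Real.sqrt_one, show (2 : ℝ) + 2 * 1 = 2 ^ 2 by norm_num,
        Real.sqrt_sq zero_le_two]
    have hmono : StrictMonoOn (fun r => ENNReal.ofReal
        (4 - 2 * Real.sqrt (2 + 2 * Real.sqrt (1 - r))) ^ (1 / 2 : ℝ)) (Set.Ico 0 1) :=
      fun _ hr _ hr' h => ENNReal.rpow_lt_rpow (strictMonoOn_ofReal_of_zero
        strictMonoOn_wasserstein2 (by rw [hsqrt]; norm_num) hr hr' h) (by norm_num)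
    exact copulaDistIncreases_of_strictMonoOn hmono
      (fun _ _ => ENNReal.rpow_ne_top_of_nonneg (by norm_num) ENNReal.ofReal_ne_top)
      mr mr' ms hside
      ((hX.dependence_of_stdNormal hne hXi hXj _).trans (wasserstein2_correlate hr))
      ((hX'.dependence_of_stdNormal hne hXi' hXj' _).trans (wasserstein2_correlate hr'))
      ((hY.dependence_of_stdNormal hne hYi hYj _).trans (wasserstein2_correlate hs))
  · have hmono : StrictMonoOn (fun r => Real.sqrt (mmdSq γ r)) (Set.Ico 0 1) :=
      fun _ hr _ hr' h => Real.sqrt_lt_sqrt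
        (mmdSq_zero hγ ▸ (strictMonoOn_mmdSq hγ).monotoneOn (Set.left_mem_Ico.2 one_pos) hr hr.1)
        (strictMonoOn_mmdSq hγ hr hr' h)
    exact copulaDistIncreases_of_strictMonoOn
      (strictMonoOn_ofReal hmono fun _ _ => Real.sqrt_nonneg _) (fun _ _ => ENNReal.ofReal_ne_top)
      mr mr' ms hside
      ((hX.dependence_of_stdNormal hne hXi hXj _).trans (gaussianMMD_correlate hγ hr))
      ((hX'.dependence_of_stdNormal hne hXi' hXj' _).trans (gaussianMMD_correlate hγ hr'))
      ((hY.dependence_of_stdNormal hne hYi hYj _).trans (gaussianMMD_correlate hγ hs))
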